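/- Theorem (removable singularity). Let $n\in\mathbb N$, let $B_1\subset\mathbb R^4$ be the open unit ball, and let $V=(V^\alpha_{ij})\in W^{1,2}(B_1,M_n\otimes\wedge^1\mathbb R^4)$, $w=(w_{ij})\in L^2(B_1,M_n)$, $\omega=(\omega_{ij})\in L^2(B_1,so_n)$, $F=(F^\alpha_{ij})\in L^{4/3,1}(B_1,M_n\otimes\wedge^1\mathbb R^4)$ (Lorentz space), $W=\nabla\omega+F$, and let $f\in L^p(B_1,\mathbb R^n)$ for some $p>1$ or $f\in L\log L(B_1,\mathbb R^n)$. Here $M_n$ denotes the real $n\times n$ matrices and $so_n$ the skew-symmetric ones. Consider the inhomogeneous Lamm–Rivière system $$\Delta^2u=\Delta(V\cdot\nabla u)+\operatorname{div}(w\nabla u)+W\cdot\nabla u+f .\qquad(*)$$ For $\Omega=B_1$ or $\Omega=B_1\setminus\{0\}$, a function $u\in W^{2,2}(\Omega,\mathbb R^n)$ is called a weak solution of $(*)$ in $\Omega$ if for all $\varphi\in W^{2,2}_0\cap L^\infty(\Omega,\mathbb R^n)$, where $W^{2,2}_0(\Omega)$ is the closure of $C_c^\infty(\Omega)$ in $W^{2,2}(\Omega)$,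 $$\int_\Omega\Delta u^i\,\Delta\varphi^i=\int_\Omega\Big(-\partial_\beta\big(V^\alpha_{ij}\partial_\alpha u^j\big)\,\partial_\beta\varphi^i-w_{ij}\,\partial_\alpha u^j\,\partial_\alpha\varphi^i-\omega_{ij}\,\partial_\alpha\big(\partial_\alpha u^j\,\varphi^i\big)+F^\alpha_{ij}\,\partial_\alpha u^j\,\varphi^i+f^i\varphi^i\Big),$$ with summation over repeated indices ($1\le i,j\le n$, $1\le\alpha,\beta\le4$), weak derivatives, and the derivatives of products given by the Leibniz rule. If $u\in W^{2,2}(B_1,\mathbb R^n)$ is a weak solution of $(*)$ in $B_1\setminus\{0\}$, then $u$ is a weak solution of $(*)$ in $B_1$. -/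

import Mathlib

open MeasureTheory Set
open scoped ENNReal

noncomputable section

namespace LammRiviere

/-- The Euclidean space `ℝ⁴`. -/
abbrev E4 : Type := EuclideanSpace ℝ (Fin 4)

/-- The open unit ball `B₁ ⊂ ℝ⁴`. -/
def B1 : Set E4 := Metric.ball 0 1

/-- The classical partial derivative `∂_α ψ`. -/
def pd (α : Fin 4) (ψ : E4 → ℝ) (x : E4) : ℝ :=
  fderiv ℝ ψ x (EuclideanSpace.single α (1 : ℝ))

/-- `ψ ∈ C_c^∞(Ω)`. -/
def IsTestFunction (Ω : Set E4) (ψ : E4 → ℝ) : Prop :=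
  ContDiff ℝ ((⊤ : ℕ∞) : WithTop ℕ∞) ψ ∧ HasCompactSupport ψ ∧ tsupport ψ ⊆ Ω

/-- `h ∈ L¹_loc(Ω)` is a weak `α`-th partial derivative of `g ∈ L¹_loc(Ω)` in the open set `Ω`. -/
def HasWeakDeriv (Ω : Set E4) (α : Fin 4) (g h : E4 → ℝ) : Prop :=
  LocallyIntegrableOn g Ω volume ∧ LocallyIntegrableOn h Ω volume ∧
    ∀ ψ : E4 → ℝ, IsTestFunction Ω ψ →
      ∫ x in Ω, g x * pd α ψ x = - ∫ x in Ω, h x * ψ x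

open Classical in
/-- The weak derivative `∂_α g` in `Ω`: it is unique up to null sets, and one representative is
chosen; if `g` has no weak derivative, the value is `0`. -/
def weakDeriv (Ω : Set E4) (α : Fin 4) (g : E4 → ℝ) : E4 → ℝ :=
  if h : ∃ v : E4 → ℝ, HasWeakDeriv Ω α g v then h.choose else 0

/-- The second weak derivative `∂_α ∂_β g` in `Ω`. -/
def weakDeriv₂ (Ω : Set E4) (α β : Fin 4) (g : E4 → ℝ) : E4 → ℝ :=
  weakDeriv Ω α (weakDeriv Ω β g)

/-- The weak Laplacian `Δ g = ∑_α ∂_α ∂_α g` in `Ω`. -/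
def weakLaplacian (Ω : Set E4) (g : E4 → ℝ) (x : E4) : ℝ :=
  ∑ α, weakDeriv₂ Ω α α g x

/-- `g ∈ L^p(Ω)`. -/
def MemL (p : ℝ≥0∞) (Ω : Set E4) (g : E4 → ℝ) : Prop :=
  MemLp g p (volume.restrict Ω)

/-- `g ∈ W^{1,2}(Ω)`: `g ∈ L²(Ω)`, and all first weak derivatives exist and lie in `L²(Ω)`. -/
def MemW12 (Ω : Set E4) (g : E4 → ℝ) : Prop :=
  MemL 2 Ω g ∧ ∀ α, HasWeakDeriv Ω α g (weakDeriv Ω α g) ∧ MemL 2 Ω (weakDeriv Ω α g)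

/-- `g ∈ W^{2,2}(Ω)`: `g ∈ L²(Ω)`, and all first weak derivatives exist and lie in
`W^{1,2}(Ω)`. -/
def MemW22 (Ω : Set E4) (g : E4 → ℝ) : Prop :=
  MemL 2 Ω g ∧ ∀ α, HasWeakDeriv Ω α g (weakDeriv Ω α g) ∧ MemW12 Ω (weakDeriv Ω α g)

/-- The norm of `W^{2,2}(Ω)` (used for elements of this space only). -/
def normW22 (Ω : Set E4) (g : E4 → ℝ) : ℝ≥0∞ :=
  eLpNorm g 2 (volume.restrict Ω)
    + ∑ α, eLpNorm (weakDeriv Ω α g) 2 (volume.restrict Ω)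
    + ∑ α, ∑ β, eLpNorm (weakDeriv₂ Ω α β g) 2 (volume.restrict Ω)

/-- `g ∈ W₀^{2,2}(Ω)`, the closure of `C_c^∞(Ω)` in `W^{2,2}(Ω)`. -/
def MemW022 (Ω : Set E4) (g : E4 → ℝ) : Prop :=
  MemW22 Ω g ∧ ∀ ε : ℝ≥0∞, 0 < ε →
    ∃ ψ : E4 → ℝ, IsTestFunction Ω ψ ∧ normW22 Ω (fun x => g x - ψ x) < ε

/-- The nonincreasing rearrangement
`g^*(t) = inf {s > 0 : |{x ∈ Ω : |g(x)| > s}| ≤ t}`. -/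
def rearrangement (Ω : Set E4) (g : E4 → ℝ) (t : ℝ) : ℝ≥0∞ :=
  sInf {s : ℝ≥0∞ | 0 < s ∧ (volume.restrict Ω) {x | s < ‖g x‖ₑ} ≤ ENNReal.ofReal t}

/-- `g^{**}(t) = (1/t) ∫_0^t g^*(s) ds`. -/
def maximalRearrangement (Ω : Set E4) (g : E4 → ℝ) (t : ℝ) : ℝ≥0∞ :=
  (∫⁻ s in Ioo 0 t, rearrangement Ω g s) / ENNReal.ofReal t

/-- The Lorentz norm `(∫_0^∞ (t^{1/p} g^{**}(t))^q dt/t)^{1/q}` for finite `p` and `q`. -/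
def lorentzNorm (p q : ℝ) (Ω : Set E4) (g : E4 → ℝ) : ℝ≥0∞ :=
  (∫⁻ t in Ioi (0 : ℝ),
    (ENNReal.ofReal t ^ (1 / p) * maximalRearrangement Ω g t) ^ q / ENNReal.ofReal t) ^ (1 / q)

/-- `g ∈ L^{p,q}(Ω)`. -/
def MemLorentz (p q : ℝ) (Ω : Set E4) (g : E4 → ℝ) : Prop :=
  AEStronglyMeasurable g (volume.restrict Ω) ∧ lorentzNorm p q Ω g < ∞

/-- `g ∈ L log L(Ω)`, that is, `∫_0^∞ g^*(t) log (2 + 1/t) dt < ∞`. -/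
def MemLlogL (Ω : Set E4) (g : E4 → ℝ) : Prop :=
  AEStronglyMeasurable g (volume.restrict Ω) ∧
    ∫⁻ t in Ioi (0 : ℝ), rearrangement Ω g t * ENNReal.ofReal (Real.log (2 + 1 / t)) < ∞

/-- The coefficients `V, w, ω, F` and the drift term `f` of the system, where
`V = (V^α_{ij})` and `F = (F^α_{ij})` are `M_n ⊗ ∧¹ℝ⁴`-valued, `w` and `ω` are `M_n`-valued and
`f` is `ℝⁿ`-valued. The coefficient `W` is `∇ω + F`. -/
structure Coefficients (n : ℕ) where
  V : Fin 4 → E4 → Matrix (Fin n) (Fin n) ℝ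
  w : E4 → Matrix (Fin n) (Fin n) ℝ
  ω : E4 → Matrix (Fin n) (Fin n) ℝ
  F : Fin 4 → E4 → Matrix (Fin n) (Fin n) ℝ
  f : Fin n → E4 → ℝ

/-- The function spaces of the coefficients: `V ∈ W^{1,2}`, `w ∈ L²`, `ω ∈ L²` with values in
`so_n`, `F ∈ L^{4/3,1}`, and `f ∈ L^p` for some `p > 1` or `f ∈ L log L`. -/
structure Coefficients.Admissible {n : ℕ} (c : Coefficients n) (Ω : Set E4) : Prop where
  V_mem : ∀ α i j, MemW12 Ω (fun x => c.V α x i j)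
  w_mem : ∀ i j, MemL 2 Ω (fun x => c.w x i j)
  ω_mem : ∀ i j, MemL 2 Ω (fun x => c.ω x i j)
  ω_skew : ∀ᵐ x ∂(volume.restrict Ω), (c.ω x).transpose = - c.ω x
  F_mem : ∀ α i j, MemLorentz (4 / 3) 1 Ω (fun x => c.F α x i j)
  f_mem : (∃ p : ℝ≥0∞, 1 < p ∧ ∀ i, MemL p Ω (c.f i)) ∨ ∀ i, MemLlogL Ω (c.f i)

/-- The function `u ∈ W^{2,2}(Ω, ℝⁿ)` is a weak solution in `Ω` of
`Δ²u = Δ(V·∇u) + div(w∇u) + W·∇u + f`, `W = ∇ω + F`, tested with all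
`φ ∈ W₀^{2,2} ∩ L^∞(Ω, ℝⁿ)`:
`∫ Δuⁱ Δφⁱ = ∫ - ∇(V^α_{ij} ∂_α uʲ)·∇φⁱ - w_{ij} ∂_α uʲ ∂_α φⁱ + ⟨W^α_{ij}, ∂_α uʲ φⁱ⟩ + fⁱ φⁱ`.
In the first term `∂_β(V^α_{ij} ∂_α uʲ) = ∂_β V^α_{ij} ∂_α uʲ + V^α_{ij} ∂_β ∂_α uʲ`; the
distribution `∂_α ω_{ij} ∈ W^{-1,2}` pairs with `∂_α uʲ φⁱ` as
`- ∫ ω_{ij} ∂_α(∂_α uʲ φⁱ) = - ∫ ω_{ij} (∂_α ∂_α uʲ φⁱ + ∂_α uʲ ∂_α φⁱ)`. -/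
def IsWeakSolution {n : ℕ} (Ω : Set E4) (c : Coefficients n) (u : Fin n → E4 → ℝ) : Prop :=
  (∀ i, MemW22 Ω (u i)) ∧
  ∀ φ : Fin n → E4 → ℝ, (∀ i, MemW022 Ω (φ i) ∧ MemL ∞ Ω (φ i)) →
    ∫ x in Ω, ∑ i, weakLaplacian Ω (u i) x * weakLaplacian Ω (φ i) x =
      ∫ x in Ω,
        (- (∑ i, ∑ j, ∑ α, ∑ β,
              (weakDeriv Ω β (fun y => c.V α y i j) x * weakDeriv Ω α (u j) x
                + c.V α x i j * weakDeriv₂ Ω β α (u j) x) * weakDeriv Ω β (φ i) x)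
          - (∑ i, ∑ j, ∑ α, c.w x i j * weakDeriv Ω α (u j) x * weakDeriv Ω α (φ i) x)
          - (∑ i, ∑ j, ∑ α, c.ω x i j *
              (weakDeriv₂ Ω α α (u j) x * φ i x
                + weakDeriv Ω α (u j) x * weakDeriv Ω α (φ i) x))
          + (∑ i, ∑ j, ∑ α, c.F α x i j * weakDeriv Ω α (u j) x * φ i x)
          + ∑ i, c.f i x * φ i x)

end LammRiviere

end

open MeasureTheory Set
open scoped ENNReal

noncomputable section

namespace LammRiviere

/-! The equation on the punctured ball is tested with `φ η_k`, where `η_k` vanishes near the origin,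
equals 1 outside the ball of radius 1/R with R = k + 2, and satisfies |∂η_k| ≤ C R and |∂²η_k| ≤ C
R² (`exists_cutoff`). These products are admissible because multiplying smooth approximants of `φ`
by `η_k` moves their supports off the origin (`MemW022.mul_smooth`).

The identity for `φ η_k` differs from the one wanted for `φ` by integrals of products A κ_k, where
κ_k is one of η_k - 1, ∂η_k, ∂²η_k. In dimension four these factors are bounded in L^∞, L⁴ and L²
respectively, and they live on shrinking balls. Hölder's inequality and absolute continuity of the
integral make the errors vanish as soon as A lies in L¹, L^{4/3} or L² respectively
(`vanishesInL1_mul`).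

The integrability of A comes from the local Sobolev embedding of W^{1,2} in L⁴
(`MemW12.memLp_four_mul_testFunction`), applied to V, ∇u and ∇φ, from L^{4/3,1} ⊂ L^{4/3}
(`MemLorentz.memL`) and from f ∈ L¹. Boundedness of `φ` covers the terms in which `φ` is not
differentiated. All estimates take place in the half ball: only differences of integrands are
compared, so nothing is needed near the boundary (`norm_integral_sub_integral_le`). -/

/-! ### Calculus of smooth functions and test functions -/

/-- Smooth real functions on `ℝ⁴`. -/
abbrev IsSmooth (η : E4 → ℝ) : Prop := ContDiff ℝ ((⊤ : ℕ∞) : WithTop ℕ∞) η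

lemma IsSmooth.pd {η : E4 → ℝ} (hη : IsSmooth η) (α : Fin 4) : IsSmooth (pd α η) :=
  (hη.fderiv_right (m := ((⊤ : ℕ∞) : WithTop ℕ∞)) (by simp)).clm_apply contDiff_const

lemma IsSmooth.differentiable {η : E4 → ℝ} (hη : IsSmooth η) : Differentiable ℝ η :=
  ContDiff.differentiable hη (by simp)

lemma pd_mul {f g : E4 → ℝ} (hf : IsSmooth f) (hg : IsSmooth g) (α : Fin 4) (x : E4) :
    pd α (fun y => f y * g y) x = f x * pd α g x + g x * pd α f x := by
  simp only [pd]
  rw [fderiv_fun_mul hf.differentiable.differentiableAt hg.differentiable.differentiableAt]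
  simp

lemma support_pd_subset (α : Fin 4) (ψ : E4 → ℝ) :
    Function.support (pd α ψ) ⊆ tsupport ψ := by
  intro x hx
  by_contra h
  apply hx
  have := support_fderiv_subset ℝ (f := ψ)
  have h2 : fderiv ℝ ψ x = 0 := by
    by_contra h3
    exact h (this h3)
  simp [pd, h2]

lemma tsupport_pd_subset (α : Fin 4) (ψ : E4 → ℝ) : tsupport (pd α ψ) ⊆ tsupport ψ :=
  closure_minimal (support_pd_subset α ψ) (isClosed_tsupport _)

lemma IsTestFunction.isSmooth {Ω : Set E4} {ψ : E4 → ℝ} (h : IsTestFunction Ω ψ) : IsSmooth ψ :=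
  h.1

lemma IsTestFunction.pd {Ω : Set E4} {ψ : E4 → ℝ} (h : IsTestFunction Ω ψ) (α : Fin 4) :
    IsTestFunction Ω (pd α ψ) :=
  ⟨h.isSmooth.pd α, h.2.1.of_isClosed_subset (isClosed_tsupport _) (tsupport_pd_subset α ψ),
    (tsupport_pd_subset α ψ).trans h.2.2⟩

lemma IsTestFunction.mono {Ω Ω' : Set E4} {ψ : E4 → ℝ} (h : IsTestFunction Ω ψ) (hΩ : Ω ⊆ Ω') :
    IsTestFunction Ω' ψ :=
  ⟨h.1, h.2.1, h.2.2.trans hΩ⟩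

lemma IsTestFunction.smooth_mul {Ω : Set E4} {η ψ : E4 → ℝ} (h : IsTestFunction Ω ψ)
    (hη : IsSmooth η) : IsTestFunction Ω (fun x => η x * ψ x) :=
  ⟨hη.mul h.1, h.2.1.mul_left, (tsupport_mul_subset_right (f := η) (g := ψ)).trans h.2.2⟩

/-! ### Weak derivatives: locality, uniqueness, product rule -/

lemma integrable_mul_of_tsupport_subset {Ω : Set E4} {g ψ : E4 → ℝ}
    (hg : LocallyIntegrableOn g Ω volume) (hψ : Continuous ψ) (hc : HasCompactSupport ψ)
    (hs : tsupport ψ ⊆ Ω) : Integrable (fun x => g x * ψ x) volume := by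
  have h1 : IntegrableOn g (tsupport ψ) volume := hg.integrableOn_compact_subset hs hc
  have h2 : IntegrableOn (fun x => g x * ψ x) (tsupport ψ) volume :=
    h1.mul_continuousOn hψ.continuousOn hc
  refine (integrableOn_iff_integrable_of_support_subset ?_).1 h2
  exact (Function.support_mul_subset_right g ψ).trans (subset_tsupport ψ)

lemma IsTestFunction.integrable_mul {Ω : Set E4} {g ψ : E4 → ℝ} (h : IsTestFunction Ω ψ)
    (hg : LocallyIntegrableOn g Ω volume) : Integrable (fun x => g x * ψ x) volume :=
  integrable_mul_of_tsupport_subset hg h.1.continuous h.2.1 h.2.2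

lemma IsTestFunction.setIntegral_mul {Ω : Set E4} {ψ : E4 → ℝ} (h : IsTestFunction Ω ψ)
    (g : E4 → ℝ) : ∫ x in Ω, g x * ψ x = ∫ x, g x * ψ x := by
  apply setIntegral_eq_integral_of_forall_compl_eq_zero
  intro x hx
  rw [image_eq_zero_of_notMem_tsupport (fun h' => hx (h.2.2 h')), mul_zero]

/-- Test functions vanish off Ω, so integrals may run over the whole space. Passing to a smaller
domain then merely leaves fewer test functions. -/
lemma hasWeakDeriv_iff {Ω : Set E4} {α : Fin 4} {g h : E4 → ℝ} :
    HasWeakDeriv Ω α g h ↔ LocallyIntegrableOn g Ω volume ∧ LocallyIntegrableOn h Ω volume ∧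
      ∀ ψ : E4 → ℝ, IsTestFunction Ω ψ → ∫ x, g x * pd α ψ x = - ∫ x, h x * ψ x := by
  refine and_congr_right fun _ => and_congr_right fun _ => forall₂_congr fun ψ hψ => ?_
  rw [hψ.setIntegral_mul, (hψ.pd α).setIntegral_mul]

lemma HasWeakDeriv.mono {Ω Ω' : Set E4} {α : Fin 4} {g h : E4 → ℝ} (H : HasWeakDeriv Ω α g h)
    (hΩ : Ω' ⊆ Ω) : HasWeakDeriv Ω' α g h := by
  rw [hasWeakDeriv_iff] at H ⊢
  exact ⟨H.1.mono_set hΩ, H.2.1.mono_set hΩ, fun ψ hψ => H.2.2 ψ (hψ.mono hΩ)⟩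

lemma HasWeakDeriv.congr {Ω : Set E4} {α : Fin 4} {g g' h h' : E4 → ℝ}
    (H : HasWeakDeriv Ω α g h) (hg : g =ᵐ[volume.restrict Ω] g')
    (hh : h =ᵐ[volume.restrict Ω] h') : HasWeakDeriv Ω α g' h' := by
  refine ⟨H.1.congr hg, H.2.1.congr hh, fun ψ hψ => ?_⟩
  have e1 : ∫ x in Ω, g' x * LammRiviere.pd α ψ x = ∫ x in Ω, g x * LammRiviere.pd α ψ x :=
    integral_congr_ae (by filter_upwards [hg] with x hx; rw [hx])
  have e2 : ∫ x in Ω, h' x * ψ x = ∫ x in Ω, h x * ψ x :=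
    integral_congr_ae (by filter_upwards [hh] with x hx; rw [hx])
  rw [e1, e2]
  exact H.2.2 ψ hψ

/-- This is the fundamental lemma of the calculus of variations, applied to the difference. -/
lemma HasWeakDeriv.unique {Ω : Set E4} (hΩ : IsOpen Ω) {α : Fin 4} {g h h' : E4 → ℝ}
    (H : HasWeakDeriv Ω α g h) (H' : HasWeakDeriv Ω α g h') : h =ᵐ[volume.restrict Ω] h' := by
  rw [hasWeakDeriv_iff] at H H'
  have key := hΩ.ae_eq_zero_of_integral_contDiff_smul_eq_zero (μ := volume)
    (f := fun x => h x - h' x) (H.2.1.sub H'.2.1) (fun ψ h1 h2 h3 => by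
      have hψ : IsTestFunction Ω ψ := ⟨h1, h2, h3⟩
      have e1 := H.2.2 ψ hψ
      have e2 := H'.2.2 ψ hψ
      have : ∀ x, ψ x • (h x - h' x) = h x * ψ x - h' x * ψ x := fun x => by
        simp only [smul_eq_mul]; ring
      simp_rw [this]
      rw [integral_sub (hψ.integrable_mul H.2.1) (hψ.integrable_mul H'.2.1)]
      linarith)
  rw [Filter.EventuallyEq, ae_restrict_iff' hΩ.measurableSet]
  filter_upwards [key] with x hx hxΩ
  exact sub_eq_zero.1 (hx hxΩ)

lemma HasWeakDeriv.sub {Ω : Set E4} {α : Fin 4} {g g' h h' : E4 → ℝ}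
    (H : HasWeakDeriv Ω α g h) (H' : HasWeakDeriv Ω α g' h') :
    HasWeakDeriv Ω α (fun x => g x - g' x) (fun x => h x - h' x) := by
  rw [hasWeakDeriv_iff] at H H' ⊢
  refine ⟨H.1.sub H'.1, H.2.1.sub H'.2.1, fun ψ hψ => ?_⟩
  simp_rw [sub_mul]
  rw [integral_sub ((hψ.pd α).integrable_mul H.1) ((hψ.pd α).integrable_mul H'.1),
    integral_sub (hψ.integrable_mul H.2.1) (hψ.integrable_mul H'.2.1), H.2.2 ψ hψ, H'.2.2 ψ hψ]
  ring

/-- The defining identity for `g` is used with the test function `η ψ`; the classical product rule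
does the rest. -/
lemma HasWeakDeriv.mul_smooth {Ω : Set E4} (hΩ : IsOpen Ω) {α : Fin 4} {g h η : E4 → ℝ}
    (H : HasWeakDeriv Ω α g h) (hη : IsSmooth η) :
    HasWeakDeriv Ω α (fun x => g x * η x) (fun x => h x * η x + g x * pd α η x) := by
  rw [hasWeakDeriv_iff] at H ⊢
  have hl := hΩ.isLocallyClosed
  refine ⟨H.1.mul_continuousOn hη.continuous.continuousOn hl,
    (H.2.1.mul_continuousOn hη.continuous.continuousOn hl).add
      (H.1.mul_continuousOn (hη.pd α).continuous.continuousOn hl), fun ψ hψ => ?_⟩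
  have h1 := H.2.2 _ (hψ.smooth_mul hη)
  simp_rw [pd_mul hη hψ.isSmooth] at h1
  have i1 := ((hψ.pd α).smooth_mul hη).integrable_mul H.1
  have i2 := (hψ.smooth_mul (hη.pd α)).integrable_mul H.1
  have i3 := (hψ.smooth_mul hη).integrable_mul H.2.1
  have e1 : ∫ x, g x * (η x * LammRiviere.pd α ψ x + ψ x * LammRiviere.pd α η x) =
      (∫ x, g x * (η x * LammRiviere.pd α ψ x)) + ∫ x, g x * (LammRiviere.pd α η x * ψ x) := by
    rw [← integral_add i1 i2]
    exact integral_congr_ae (Filter.Eventually.of_forall fun x => by ring)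
  have e2 : ∫ x, (h x * η x + g x * LammRiviere.pd α η x) * ψ x =
      (∫ x, h x * (η x * ψ x)) + ∫ x, g x * (LammRiviere.pd α η x * ψ x) := by
    rw [← integral_add i3 i2]
    exact integral_congr_ae (Filter.Eventually.of_forall fun x => by ring)
  have e3 : ∫ x, g x * η x * LammRiviere.pd α ψ x = ∫ x, g x * (η x * LammRiviere.pd α ψ x) :=
    integral_congr_ae (Filter.Eventually.of_forall fun x => by ring)
  rw [e2, e3]
  rw [e1] at h1
  linarith

lemma IsSmooth.hasWeakDeriv {η : E4 → ℝ} (hη : IsSmooth η) (Ω : Set E4) (α : Fin 4) :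
    HasWeakDeriv Ω α η (LammRiviere.pd α η) := by
  rw [hasWeakDeriv_iff]
  have l1 := (hη.continuous.locallyIntegrable (μ := volume)).locallyIntegrableOn Ω
  have l2 := ((hη.pd α).continuous.locallyIntegrable (μ := volume)).locallyIntegrableOn Ω
  refine ⟨l1, l2, fun ψ hψ => ?_⟩
  exact integral_mul_fderiv_eq_neg_fderiv_mul_of_integrable (hψ.integrable_mul l2)
    ((hψ.pd α).integrable_mul l1) (hψ.integrable_mul l1)
    (fun x _ => hη.differentiable.differentiableAt)
    (fun x _ => hψ.isSmooth.differentiable.differentiableAt)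

lemma HasWeakDeriv.weakDeriv {Ω : Set E4} {α : Fin 4} {g h : E4 → ℝ}
    (H : HasWeakDeriv Ω α g h) : HasWeakDeriv Ω α g (weakDeriv Ω α g) := by
  have h' : ∃ v : E4 → ℝ, HasWeakDeriv Ω α g v := ⟨h, H⟩
  rw [LammRiviere.weakDeriv, dif_pos h']
  exact h'.choose_spec

/-- Through this fact the representative picked by choice can be exchanged for any explicit
derivative. -/
lemma HasWeakDeriv.weakDeriv_ae_eq {Ω : Set E4} (hΩ : IsOpen Ω) {α : Fin 4} {g h : E4 → ℝ}
    (H : HasWeakDeriv Ω α g h) : LammRiviere.weakDeriv Ω α g =ᵐ[volume.restrict Ω] h :=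
  H.weakDeriv.unique hΩ H

/-! ### Membership and norm in W^{1,2} and W^{2,2} from explicit derivatives -/

lemma MemW22.hasWeakDeriv {Ω : Set E4} {g : E4 → ℝ} (h : MemW22 Ω g) (α : Fin 4) :
    HasWeakDeriv Ω α g (weakDeriv Ω α g) := (h.2 α).1

lemma MemW22.hasWeakDeriv₂ {Ω : Set E4} {g : E4 → ℝ} (h : MemW22 Ω g) (β α : Fin 4) :
    HasWeakDeriv Ω β (weakDeriv Ω α g) (weakDeriv₂ Ω β α g) := ((h.2 α).2.2 β).1

lemma MemW22.memL_weakDeriv {Ω : Set E4} {g : E4 → ℝ} (h : MemW22 Ω g) (α : Fin 4) :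
    MemL 2 Ω (weakDeriv Ω α g) := (h.2 α).2.1

lemma MemW22.memL_weakDeriv₂ {Ω : Set E4} {g : E4 → ℝ} (h : MemW22 Ω g) (β α : Fin 4) :
    MemL 2 Ω (weakDeriv₂ Ω β α g) := ((h.2 α).2.2 β).2

lemma MemL.mono_set {p : ℝ≥0∞} {Ω Ω' : Set E4} {g : E4 → ℝ} (h : MemL p Ω g) (hΩ : Ω' ⊆ Ω) :
    MemL p Ω' g := MemLp.mono_measure (Measure.restrict_mono hΩ le_rfl) h

lemma weakDeriv₂_ae_eq {Ω : Set E4} (hΩ : IsOpen Ω) {g D H : E4 → ℝ} {α β : Fin 4}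
    (hD : HasWeakDeriv Ω α g D) (hH : HasWeakDeriv Ω β D H) :
    weakDeriv₂ Ω β α g =ᵐ[volume.restrict Ω] H :=
  (hH.congr (hD.weakDeriv_ae_eq hΩ).symm Filter.EventuallyEq.rfl).weakDeriv_ae_eq hΩ

lemma memW12_of_hasWeakDeriv {Ω : Set E4} (hΩ : IsOpen Ω) {g : E4 → ℝ} {D : Fin 4 → E4 → ℝ}
    (hg : MemL 2 Ω g) (hD : ∀ α, HasWeakDeriv Ω α g (D α)) (hD2 : ∀ α, MemL 2 Ω (D α)) :
    MemW12 Ω g :=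
  ⟨hg, fun α => ⟨(hD α).weakDeriv, (memLp_congr_ae ((hD α).weakDeriv_ae_eq hΩ)).2 (hD2 α)⟩⟩

lemma memW22_of_hasWeakDeriv {Ω : Set E4} (hΩ : IsOpen Ω) {g : E4 → ℝ} {D : Fin 4 → E4 → ℝ}
    {H : Fin 4 → Fin 4 → E4 → ℝ} (hg : MemL 2 Ω g) (hD : ∀ α, HasWeakDeriv Ω α g (D α))
    (hD2 : ∀ α, MemL 2 Ω (D α)) (hH : ∀ β α, HasWeakDeriv Ω β (D α) (H β α))
    (hH2 : ∀ β α, MemL 2 Ω (H β α)) : MemW22 Ω g := by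
  refine ⟨hg, fun α => ⟨(hD α).weakDeriv, ?_⟩⟩
  have e := (hD α).weakDeriv_ae_eq hΩ
  exact memW12_of_hasWeakDeriv hΩ ((memLp_congr_ae e).2 (hD2 α))
    (fun β => (hH β α).congr e.symm Filter.EventuallyEq.rfl) (fun β => hH2 β α)

lemma normW22_eq_of_hasWeakDeriv {Ω : Set E4} (hΩ : IsOpen Ω) {g : E4 → ℝ} {D : Fin 4 → E4 → ℝ}
    {H : Fin 4 → Fin 4 → E4 → ℝ} (hD : ∀ α, HasWeakDeriv Ω α g (D α))
    (hH : ∀ β α, HasWeakDeriv Ω β (D α) (H β α)) :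
    normW22 Ω g = eLpNorm g 2 (volume.restrict Ω)
      + ∑ α, eLpNorm (D α) 2 (volume.restrict Ω)
      + ∑ α, ∑ β, eLpNorm (H α β) 2 (volume.restrict Ω) := by
  unfold normW22
  congr 1
  · congr 1
    exact Finset.sum_congr rfl fun α _ => eLpNorm_congr_ae ((hD α).weakDeriv_ae_eq hΩ)
  · exact Finset.sum_congr rfl fun α _ => Finset.sum_congr rfl fun β _ =>
      eLpNorm_congr_ae (weakDeriv₂_ae_eq hΩ (hD β) (hH α β))

lemma MemW22.mono {Ω Ω' : Set E4} (hΩ' : IsOpen Ω') (hs : Ω' ⊆ Ω) {g : E4 → ℝ}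
    (h : MemW22 Ω g) : MemW22 Ω' g :=
  memW22_of_hasWeakDeriv hΩ' (h.1.mono_set hs) (fun α => (h.hasWeakDeriv α).mono hs)
    (fun α => (h.memL_weakDeriv α).mono_set hs) (fun β α => (h.hasWeakDeriv₂ β α).mono hs)
    (fun β α => (h.memL_weakDeriv₂ β α).mono_set hs)

lemma MemW22.normW22_mono {Ω Ω' : Set E4} (hΩ' : IsOpen Ω') (hs : Ω' ⊆ Ω) {g : E4 → ℝ}
    (h : MemW22 Ω g) : normW22 Ω' g ≤ normW22 Ω g := by
  rw [normW22_eq_of_hasWeakDeriv hΩ' (fun α => (h.hasWeakDeriv α).mono hs)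
    (fun β α => (h.hasWeakDeriv₂ β α).mono hs), normW22]
  have hm := Measure.restrict_mono (μ := (volume : Measure E4)) hs le_rfl
  gcongr

lemma MemW22.sub {Ω : Set E4} (hΩ : IsOpen Ω) {g g' : E4 → ℝ} (h : MemW22 Ω g)
    (h' : MemW22 Ω g') : MemW22 Ω (fun x => g x - g' x) :=
  memW22_of_hasWeakDeriv hΩ (MemLp.sub h.1 h'.1)
    (fun α => (h.hasWeakDeriv α).sub (h'.hasWeakDeriv α))
    (fun α => MemLp.sub (h.memL_weakDeriv α) (h'.memL_weakDeriv α))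
    (fun β α => (h.hasWeakDeriv₂ β α).sub (h'.hasWeakDeriv₂ β α))
    (fun β α => MemLp.sub (h.memL_weakDeriv₂ β α) (h'.memL_weakDeriv₂ β α))

lemma IsTestFunction.memL {Ω : Set E4} {ψ : E4 → ℝ} (h : IsTestFunction Ω ψ) (p : ℝ≥0∞)
    (Ω' : Set E4) : MemL p Ω' ψ :=
  (h.1.continuous.memLp_of_hasCompactSupport h.2.1).restrict _

lemma IsTestFunction.memW22 {Ω : Set E4} (hΩ : IsOpen Ω) {ψ : E4 → ℝ} (h : IsTestFunction Ω ψ) :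
    MemW22 Ω ψ :=
  memW22_of_hasWeakDeriv hΩ (h.memL 2 Ω) (fun α => h.isSmooth.hasWeakDeriv Ω α)
    (fun α => (h.pd α).memL 2 Ω) (fun β α => (h.isSmooth.pd α).hasWeakDeriv Ω β)
    (fun β α => ((h.pd α).pd β).memL 2 Ω)

/-! ### Multiplication by bounded smooth functions in W^{2,2} and W₀^{2,2} -/

/-- A smooth function that is bounded by `C` together with its derivatives of order up to two. -/
structure IsBddSmooth (C : ℝ) (η : E4 → ℝ) : Prop where
  smooth : IsSmooth η
  bound : ∀ x, |η x| ≤ C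
  bound_pd : ∀ α x, |pd α η x| ≤ C
  bound_pd_pd : ∀ β α x, |pd β (pd α η) x| ≤ C

lemma MemL.mul_of_continuous_of_bound {p : ℝ≥0∞} {Ω : Set E4} {g η : E4 → ℝ} {C : ℝ}
    (hg : MemL p Ω g) (hη : Continuous η) (hC : ∀ x, |η x| ≤ C) :
    MemL p Ω (fun x => g x * η x) :=
  MemLp.of_le_mul (c := C) hg (hg.1.mul hη.aestronglyMeasurable)
    (Filter.Eventually.of_forall fun x => by
      rw [norm_mul, mul_comm]
      exact mul_le_mul_of_nonneg_right (hC x) (norm_nonneg _))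

lemma eLpNorm_mul_le_of_bound {Ω : Set E4} {g η : E4 → ℝ} {C : ℝ} (hC : ∀ x, |η x| ≤ C) :
    eLpNorm (fun x => g x * η x) 2 (volume.restrict Ω) ≤
      ENNReal.ofReal C * eLpNorm g 2 (volume.restrict Ω) := by
  refine eLpNorm_le_mul_eLpNorm_of_ae_le_mul (Filter.Eventually.of_forall fun x => ?_) 2
  rw [norm_mul, mul_comm]
  exact mul_le_mul_of_nonneg_right (hC x) (norm_nonneg _)

/-- The second derivatives of a product with a smooth function. -/
lemma MemW22.hasWeakDeriv_mul_smooth₂ {Ω : Set E4} (hΩ : IsOpen Ω) {g η : E4 → ℝ}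
    (h : MemW22 Ω g) (hη : IsSmooth η) (β α : Fin 4) :
    HasWeakDeriv Ω β (fun x => weakDeriv Ω α g x * η x + g x * pd α η x)
      (fun x => (weakDeriv₂ Ω β α g x * η x + weakDeriv Ω α g x * pd β η x)
        + (weakDeriv Ω β g x * pd α η x + g x * pd β (pd α η) x)) := by
  have h1 := (h.hasWeakDeriv₂ β α).mul_smooth hΩ hη
  have h2 := (h.hasWeakDeriv β).mul_smooth hΩ (hη.pd α)
  have h3 : HasWeakDeriv Ω β (fun _ : E4 => (0 : ℝ)) (fun _ => 0) := by
    rw [hasWeakDeriv_iff]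
    exact ⟨locallyIntegrableOn_zero, locallyIntegrableOn_zero, by simp⟩
  -- The sum is written as h1 - (0 - h2), so linearity under subtraction suffices.
  have h4 := h1.sub (h3.sub h2)
  convert h4 using 1 <;> (funext x; ring)

lemma MemW22.mul_smooth {Ω : Set E4} (hΩ : IsOpen Ω) {g η : E4 → ℝ} {C : ℝ}
    (h : MemW22 Ω g) (hη : IsBddSmooth C η) : MemW22 Ω (fun x => g x * η x) := by
  have c0 := hη.smooth.continuous
  have c1 := fun α => (hη.smooth.pd α).continuous
  have c2 := fun β α => ((hη.smooth.pd α).pd β).continuous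
  refine memW22_of_hasWeakDeriv hΩ (MemL.mul_of_continuous_of_bound h.1 c0 hη.bound)
    (fun α => (h.hasWeakDeriv α).mul_smooth hΩ hη.smooth) (fun α => ?_)
    (fun β α => h.hasWeakDeriv_mul_smooth₂ hΩ hη.smooth β α) (fun β α => ?_)
  · exact MemLp.add (MemL.mul_of_continuous_of_bound (h.memL_weakDeriv α) c0 hη.bound)
      (MemL.mul_of_continuous_of_bound h.1 (c1 α) (hη.bound_pd α))
  · exact MemLp.add (MemLp.add
      (MemL.mul_of_continuous_of_bound (h.memL_weakDeriv₂ β α) c0 hη.bound)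
      (MemL.mul_of_continuous_of_bound (h.memL_weakDeriv α) (c1 β) (hη.bound_pd β)))
      (MemLp.add (MemL.mul_of_continuous_of_bound (h.memL_weakDeriv β) (c1 α) (hη.bound_pd α))
      (MemL.mul_of_continuous_of_bound h.1 (c2 β α) (hη.bound_pd_pd β α)))

/-- The Leibniz rule gives one term for the function, two for each of 4 first derivatives and four
for each of 16 second derivatives: 1 + 8 + 64 = 73, each at most C times the norm. -/
lemma MemW22.normW22_mul_smooth_le {Ω : Set E4} (hΩ : IsOpen Ω) {g η : E4 → ℝ} {C : ℝ}
    (h : MemW22 Ω g) (hη : IsBddSmooth C η) :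
    normW22 Ω (fun x => g x * η x) ≤ 73 * ENNReal.ofReal C * normW22 Ω g := by
  have c0 := hη.smooth.continuous
  have c1 := fun α => (hη.smooth.pd α).continuous
  have c2 := fun β α => ((hη.smooth.pd α).pd β).continuous
  rw [normW22_eq_of_hasWeakDeriv hΩ (fun α => (h.hasWeakDeriv α).mul_smooth hΩ hη.smooth)
    (fun β α => h.hasWeakDeriv_mul_smooth₂ hΩ hη.smooth β α)]
  set N := normW22 Ω g with hN
  have n0 : eLpNorm g 2 (volume.restrict Ω) ≤ N := by
    rw [hN, normW22, add_assoc]; exact le_self_add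
  have n1 : ∀ α, eLpNorm (weakDeriv Ω α g) 2 (volume.restrict Ω) ≤ N := fun α => by
    rw [hN, normW22]
    refine le_trans ?_ (le_self_add)
    refine le_trans ?_ (le_add_self)
    exact Finset.single_le_sum (f := fun α => eLpNorm (weakDeriv Ω α g) 2 (volume.restrict Ω))
      (fun _ _ => zero_le) (Finset.mem_univ α)
  have n2 : ∀ β α, eLpNorm (weakDeriv₂ Ω β α g) 2 (volume.restrict Ω) ≤ N := fun β α => by
    rw [hN, normW22]
    refine le_trans ?_ (le_add_self)
    refine le_trans ?_ (Finset.single_le_sum (f := fun β => ∑ α,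
      eLpNorm (weakDeriv₂ Ω β α g) 2 (volume.restrict Ω)) (fun _ _ => zero_le)
      (Finset.mem_univ β))
    exact Finset.single_le_sum (f := fun α =>
      eLpNorm (weakDeriv₂ Ω β α g) 2 (volume.restrict Ω)) (fun _ _ => zero_le)
      (Finset.mem_univ α)
  have b : ∀ {f ξ : E4 → ℝ}, eLpNorm f 2 (volume.restrict Ω) ≤ N → (∀ x, |ξ x| ≤ C) →
      eLpNorm (fun x => f x * ξ x) 2 (volume.restrict Ω) ≤ ENNReal.ofReal C * N :=
    fun hf hξ => (eLpNorm_mul_le_of_bound hξ).trans (by gcongr)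
  have m0 : AEStronglyMeasurable g (volume.restrict Ω) := h.1.1
  have m1 := fun α => (h.memL_weakDeriv α).1
  have m2 := fun β α => (h.memL_weakDeriv₂ β α).1
  have s1 : ∀ α, eLpNorm (fun x => weakDeriv Ω α g x * η x + g x * pd α η x) 2
      (volume.restrict Ω) ≤ ENNReal.ofReal C * N + ENNReal.ofReal C * N := fun α =>
    (eLpNorm_add_le ((m1 α).mul c0.aestronglyMeasurable)
      (m0.mul (c1 α).aestronglyMeasurable) one_le_two).trans
      (add_le_add (b (n1 α) hη.bound) (b n0 (hη.bound_pd α)))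
  have s2 : ∀ β α, eLpNorm (fun x => (weakDeriv₂ Ω β α g x * η x + weakDeriv Ω α g x * pd β η x)
        + (weakDeriv Ω β g x * pd α η x + g x * pd β (pd α η) x)) 2
      (volume.restrict Ω) ≤ (ENNReal.ofReal C * N + ENNReal.ofReal C * N) +
        (ENNReal.ofReal C * N + ENNReal.ofReal C * N) := fun β α => by
    have a1 := (m2 β α).mul (c0.aestronglyMeasurable (μ := volume.restrict Ω))
    have a2 := (m1 α).mul ((c1 β).aestronglyMeasurable (μ := volume.restrict Ω))
    have a3 := (m1 β).mul ((c1 α).aestronglyMeasurable (μ := volume.restrict Ω))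
    have a4 := m0.mul ((c2 β α).aestronglyMeasurable (μ := volume.restrict Ω))
    refine (eLpNorm_add_le (a1.add a2) (a3.add a4) one_le_two).trans (add_le_add ?_ ?_)
    · exact (eLpNorm_add_le a1 a2 one_le_two).trans
        (add_le_add (b (n2 β α) hη.bound) (b (n1 α) (hη.bound_pd β)))
    · exact (eLpNorm_add_le a3 a4 one_le_two).trans
        (add_le_add (b (n1 β) (hη.bound_pd α)) (b n0 (hη.bound_pd_pd β α)))
  calc _ ≤ ENNReal.ofReal C * N + ∑ _α : Fin 4, (ENNReal.ofReal C * N + ENNReal.ofReal C * N)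
        + ∑ _α : Fin 4, ∑ _β : Fin 4, ((ENNReal.ofReal C * N + ENNReal.ofReal C * N) +
        (ENNReal.ofReal C * N + ENNReal.ofReal C * N)) :=
        add_le_add (add_le_add (b n0 hη.bound) (Finset.sum_le_sum fun α _ => s1 α))
          (Finset.sum_le_sum fun β _ => Finset.sum_le_sum fun α _ => s2 β α)
    _ = 73 * ENNReal.ofReal C * N := by
        simp only [Finset.sum_const, Finset.card_univ, Fintype.card_fin, nsmul_eq_mul]
        push_cast
        ring

/-- If ψ approximates `g`, then η ψ approximates `g η`, and its support lies in the smaller domain.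
The constant may depend on η, since η is fixed during the approximation. -/
lemma MemW022.mul_smooth {Ω Ω' : Set E4} (hΩ : IsOpen Ω) (hΩ' : IsOpen Ω') (hs : Ω' ⊆ Ω)
    {g η : E4 → ℝ} {C : ℝ} (h : MemW022 Ω g) (hη : IsBddSmooth C η)
    (hsupp : Ω ∩ tsupport η ⊆ Ω') : MemW022 Ω' (fun x => g x * η x) := by
  refine ⟨(h.1.mono hΩ' hs).mul_smooth hΩ' hη, fun ε hε => ?_⟩
  -- Adding 1 keeps K nonzero, so that division by K is harmless.
  set K : ℝ≥0∞ := 73 * ENNReal.ofReal C + 1 with hK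
  have hK0 : K ≠ 0 := by simp [hK]
  have hKt : K ≠ ∞ := by
    rw [hK]
    exact ENNReal.add_ne_top.2 ⟨ENNReal.mul_ne_top (by simp) ENNReal.ofReal_ne_top, by simp⟩
  obtain ⟨ψ, hψ, hlt⟩ := h.2 (ε / K) (ENNReal.div_pos hε.ne' hKt)
  refine ⟨fun x => η x * ψ x, ⟨hη.smooth.mul hψ.1, hψ.2.1.mul_left, ?_⟩, ?_⟩
  · exact fun x hx => hsupp ⟨hψ.2.2 (tsupport_mul_subset_right (f := η) (g := ψ) hx),
      tsupport_mul_subset_left (f := η) (g := ψ) hx⟩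
  · have hd : MemW22 Ω (fun x => g x - ψ x) := h.1.sub hΩ (hψ.memW22 hΩ)
    have e : (fun x => g x * η x - η x * ψ x) = fun x => (g x - ψ x) * η x := by
      funext x; ring
    rw [e]
    calc normW22 Ω' (fun x => (g x - ψ x) * η x)
        ≤ 73 * ENNReal.ofReal C * normW22 Ω' (fun x => g x - ψ x) :=
          (hd.mono hΩ' hs).normW22_mul_smooth_le hΩ' hη
      _ ≤ K * normW22 Ω (fun x => g x - ψ x) := by
          gcongr
          · exact le_self_add
          · exact hd.normW22_mono hΩ' hs
      _ < K * (ε / K) := ENNReal.mul_lt_mul_right hK0 hKt hlt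
      _ = ε := ENNReal.mul_div_cancel hK0 hKt

/-! ### Local Sobolev embedding of W^{1,2} in L⁴ by mollification -/

open scoped Convolution

/-- Convolution with a probability density does not increase the `L²` norm. -/
lemma eLpNorm_convolution_le {H ρ : E4 → ℝ} (hH : AEStronglyMeasurable H volume)
    (hρ : Continuous ρ) (h0 : ∀ x, 0 ≤ ρ x) (hi : Integrable ρ volume) (h1 : ∫ x, ρ x = 1) :
    eLpNorm (convolution H ρ (ContinuousLinearMap.lsmul ℝ ℝ) volume) 2 volume ≤
      eLpNorm H 2 volume := by
  wlog hm : StronglyMeasurable H generalizing H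
  · have e := hH.ae_eq_mk
    rw [convolution_congr (ContinuousLinearMap.lsmul ℝ ℝ) e (Filter.EventuallyEq.refl _ ρ),
      eLpNorm_congr_ae e]
    exact this hH.stronglyMeasurable_mk.aestronglyMeasurable hH.stronglyMeasurable_mk
  set d : E4 → ℝ≥0∞ := fun t => ENNReal.ofReal (ρ t) with hd
  have hdm : Measurable d := hρ.measurable.ennreal_ofReal
  set ν : Measure E4 := volume.withDensity d with hν
  have hνp : IsProbabilityMeasure ν := ⟨by
    rw [hν, withDensity_apply _ MeasurableSet.univ, Measure.restrict_univ,
      ← ofReal_integral_eq_lintegral_ofReal hi (Filter.Eventually.of_forall h0), h1,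
      ENNReal.ofReal_one]⟩
  have hHm : Measurable H := hm.measurable
  have hsub : ∀ x : E4, Measurable fun t : E4 => H (x - t) := fun x =>
    hHm.comp (measurable_const.sub measurable_id)
  have hsub2 : ∀ t : E4, Measurable fun x : E4 => H (x - t) := fun t =>
    hHm.comp (measurable_id.sub measurable_const)
  -- The convolution averages translates of H against the probability measure ν, so its square is at
  -- most the average of the squares. Tonelli and translation invariance finish the bound.
  have hj : ∀ x, ‖(convolution H ρ (ContinuousLinearMap.lsmul ℝ ℝ) volume) x‖ₑ ^ (2 : ℝ) ≤
      ∫⁻ t, ‖H (x - t)‖ₑ ^ (2 : ℝ) ∂ν := fun x => by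
    have s1 : ‖(convolution H ρ (ContinuousLinearMap.lsmul ℝ ℝ) volume) x‖ₑ ≤
        ∫⁻ t, ‖H (x - t)‖ₑ ∂ν := by
      rw [convolution_lsmul_swap]
      refine (enorm_integral_le_lintegral_enorm _).trans (le_of_eq ?_)
      rw [hν, lintegral_withDensity_eq_lintegral_mul _ hdm (hsub x).enorm]
      refine lintegral_congr fun t => ?_
      rw [Pi.mul_apply, smul_eq_mul, enorm_mul, mul_comm, hd, Real.enorm_eq_ofReal (h0 t)]
    have s2 := eLpNorm_le_eLpNorm_of_exponent_le (μ := ν) (p := 1) (q := 2) one_le_two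
      (hsub x).aestronglyMeasurable
    rw [eLpNorm_one_eq_lintegral_enorm,
      eLpNorm_eq_lintegral_rpow_enorm_toReal (by simp) (by simp)] at s2
    have s3 := ENNReal.rpow_le_rpow (z := 2) (s1.trans s2) (by norm_num)
    rwa [← ENNReal.rpow_mul, ENNReal.toReal_ofNat, one_div,
      inv_mul_cancel₀ (two_ne_zero), ENNReal.rpow_one] at s3
  rw [eLpNorm_eq_lintegral_rpow_enorm_toReal (by simp) (by simp),
    eLpNorm_eq_lintegral_rpow_enorm_toReal (by simp) (by simp), ENNReal.toReal_ofNat]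
  refine ENNReal.rpow_le_rpow ?_ (by norm_num)
  calc ∫⁻ x, ‖(convolution H ρ (ContinuousLinearMap.lsmul ℝ ℝ) volume) x‖ₑ ^ (2 : ℝ)
      ≤ ∫⁻ x, ∫⁻ t, ‖H (x - t)‖ₑ ^ (2 : ℝ) ∂ν := lintegral_mono hj
    _ = ∫⁻ t, (∫⁻ x, ‖H (x - t)‖ₑ ^ (2 : ℝ)) ∂ν := by
        refine lintegral_lintegral_swap (μ := (volume : Measure E4)) (ν := ν)
          (Measurable.aemeasurable ?_)
        exact (hHm.comp (measurable_fst.sub measurable_snd)).enorm.pow_const _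
    _ = ∫⁻ _t, (∫⁻ x, ‖H x‖ₑ ^ (2 : ℝ)) ∂ν := lintegral_congr fun t =>
        lintegral_sub_right_eq_self (μ := (volume : Measure E4))
          (fun x => ‖H x‖ₑ ^ (2 : ℝ)) t
    _ = ∫⁻ x, ‖H x‖ₑ ^ (2 : ℝ) := by simp

lemma pd_comp_const_sub {ρ : E4 → ℝ} (hρ : IsSmooth ρ) (α : Fin 4) (x t : E4) :
    pd α (fun s => ρ (x - s)) t = - pd α ρ (x - t) := by
  have h1 : HasFDerivAt (fun s : E4 => x - s) (-ContinuousLinearMap.id ℝ E4) t :=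
    (hasFDerivAt_id t).const_sub x
  have h2 := (hρ.differentiable (x - t)).hasFDerivAt.comp t h1
  simp only [pd]
  rw [show (fun s => ρ (x - s)) = ρ ∘ fun s => x - s from rfl, h2.fderiv]
  simp

/-- A weak derivative may be moved onto the other factor of a convolution after localization. -/
lemma pd_convolution {Ω : Set E4} {α : Fin 4} {g h χ ρ : E4 → ℝ}
    (H : HasWeakDeriv Ω α g h) (hχ : IsTestFunction Ω χ) (hρ : IsSmooth ρ)
    (hc : HasCompactSupport ρ) (x : E4) :
    pd α (convolution (fun y => g y * χ y) ρ (ContinuousLinearMap.lsmul ℝ ℝ) volume) x =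
      convolution (fun y => h y * χ y + g y * pd α χ y) ρ
        (ContinuousLinearMap.lsmul ℝ ℝ) volume x := by
  have hG : Integrable (fun y => g y * χ y) volume := hχ.integrable_mul H.1
  have hd := hc.hasFDerivAt_convolution_right (ContinuousLinearMap.lsmul ℝ ℝ) (μ := volume)
    hG.locallyIntegrable (hρ.of_le (by exact_mod_cast le_top)) x
  rw [pd, hd.fderiv, convolution_precompR_apply (ContinuousLinearMap.lsmul ℝ ℝ)
    hG.locallyIntegrable (hc.fderiv ℝ)
    (hρ.continuous_fderiv (by simp)), convolution_lsmul, convolution_lsmul]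
  have hρx : IsSmooth fun t => ρ (x - t) := hρ.comp (contDiff_const.sub contDiff_id)
  -- The factor χ keeps the support in Ω for every x, even where the support of ρ(x - ·) leaves Ω.
  have hψ : IsTestFunction Ω (fun t => ρ (x - t) * χ t) := hχ.smooth_mul hρx
  have k := (hasWeakDeriv_iff.1 H).2.2 _ hψ
  simp_rw [pd_mul hρx hχ.isSmooth, pd_comp_const_sub hρ] at k
  have i1 := (((hχ.pd α).smooth_mul hρx).integrable_mul H.1)
  have hpx : IsSmooth fun t => pd α ρ (x - t) :=
    (hρ.pd α).comp (contDiff_const.sub contDiff_id)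
  have i2 := (hχ.smooth_mul hpx).integrable_mul H.1
  have i3 := hψ.integrable_mul H.2.1
  have e1 : ∫ t, g t * (ρ (x - t) * pd α χ t + χ t * -pd α ρ (x - t)) =
      (∫ t, g t * (ρ (x - t) * pd α χ t)) - ∫ t, g t * (pd α ρ (x - t) * χ t) := by
    rw [← integral_sub i1 i2]
    exact integral_congr_ae (Filter.Eventually.of_forall fun t => by ring)
  have e2 : ∫ t, (h t * χ t + g t * pd α χ t) • ρ (x - t) =
      (∫ t, h t * (ρ (x - t) * χ t)) + ∫ t, g t * (ρ (x - t) * pd α χ t) := by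
    rw [← integral_add i3 i1]
    exact integral_congr_ae (Filter.Eventually.of_forall fun t => by
      simp only [smul_eq_mul]; ring)
  have e3 : ∫ t, (g t * χ t) • (fderiv ℝ ρ (x - t)) (EuclideanSpace.single α (1 : ℝ)) =
      ∫ t, g t * (pd α ρ (x - t) * χ t) :=
    integral_congr_ae (Filter.Eventually.of_forall fun t => by
      simp only [smul_eq_mul, pd]; ring)
  rw [e2, e3]
  rw [e1] at k
  linarith

/-- The Gagliardo–Nirenberg–Sobolev inequality involves the full derivative, while mollification is
controlled one partial derivative at a time. -/
lemma norm_fderiv_le_sum_pd (f : E4 → ℝ) (x : E4) : ‖fderiv ℝ f x‖ ≤ ∑ α, |pd α f x| := by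
  refine ContinuousLinearMap.opNorm_le_bound _ (Finset.sum_nonneg fun _ _ => abs_nonneg _)
    fun v => ?_
  have hv : v = ∑ α, v α • EuclideanSpace.single α (1 : ℝ) := by
    ext i
    simp [Finset.sum_apply, Pi.single_apply]
  conv_lhs => rw [hv]
  rw [map_sum, Finset.sum_mul]
  refine (norm_sum_le _ _).trans (Finset.sum_le_sum fun α _ => ?_)
  rw [map_smul, norm_smul, mul_comm]
  exact mul_le_mul_of_nonneg_left (PiLp.norm_apply_le v α) (abs_nonneg _)

/-- Sobolev embedding `W^{1,2} ⊂ L⁴` in dimension four, for localized functions. -/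
lemma MemW12.memLp_four_mul_testFunction {Ω : Set E4} (hΩ : IsOpen Ω) {g χ : E4 → ℝ}
    (hg : MemW12 Ω g) (hχ : IsTestFunction Ω χ) :
    MemLp (fun x => g x * χ x) 4 volume := by
  set G : E4 → ℝ := fun x => g x * χ x with hGdef
  set D : Fin 4 → E4 → ℝ := fun α x => weakDeriv Ω α g x * χ x + g x * pd α χ x with hDdef
  have hW := fun α => (hg.2 α).1
  have hGi : Integrable G volume := hχ.integrable_mul (hW 0).1
  have hext : ∀ {f ψ : E4 → ℝ}, MemL 2 Ω f → IsTestFunction Ω ψ →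
      MemLp (fun x => f x * ψ x) 2 volume := fun {f ψ} hf hψ => by
    obtain ⟨C, hC⟩ := hψ.1.continuous.bounded_above_of_compact_support hψ.2.1
    have h1 : MemLp (fun x => f x * ψ x) 2 (volume.restrict Ω) :=
      MemL.mul_of_continuous_of_bound hf hψ.1.continuous hC
    have h2 : Ω.indicator (fun x => f x * ψ x) = fun x => f x * ψ x := by
      rw [indicator_eq_self]
      exact (Function.support_mul_subset_right f ψ).trans ((subset_tsupport ψ).trans hψ.2.2)
    rw [← h2]
    exact (memLp_indicator_iff_restrict hΩ.measurableSet).2 h1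
  have hD2 : ∀ α, MemLp (D α) 2 volume := fun α =>
    (hext (hg.2 α).2 hχ).add (hext hg.1 (hχ.pd α))
  set K := SNormLESNormFDerivOfEqConst ℝ (volume : Measure E4) 2 with hK
  let φ : ℕ → ContDiffBump (0 : E4) := fun n =>
    ⟨1 / (n + 1), 2 / (n + 1), by positivity, by gcongr; norm_num⟩
  let M : ℕ → E4 → ℝ := fun n =>
    convolution G ((φ n).normed volume) (ContinuousLinearMap.lsmul ℝ ℝ) volume
  have hρs : ∀ n, IsSmooth ((φ n).normed volume) := fun n => (φ n).contDiff_normed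
  have hρc : ∀ n, HasCompactSupport ((φ n).normed volume) :=
    fun n => (φ n).hasCompactSupport_normed
  have hGc : HasCompactSupport G := hχ.2.1.mul_left
  have hMs : ∀ n, IsSmooth (M n) := fun n =>
    (hρc n).contDiff_convolution_right _ hGi.locallyIntegrable (hρs n)
  have hMc : ∀ n, HasCompactSupport (M n) := fun n => hGc.convolution _ (hρc n)
  -- Gagliardo–Nirenberg–Sobolev with 1/4 = 1/2 - 1/4 bounds the mollifications uniformly in n;
  -- Fatou's lemma then passes the bound to the limit.
  have hb : ∀ n, eLpNorm (M n) 4 volume ≤ K * ∑ α, eLpNorm (D α) 2 volume := fun n => by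
    have gns := eLpNorm_le_eLpNorm_fderiv_of_eq (F := ℝ) (μ := (volume : Measure E4)) (p := 2)
      (p' := 4) ((hMs n).of_le (by exact_mod_cast le_top)) (hMc n) (by norm_num)
      (by simp) (by simp; norm_num)
    refine gns.trans (mul_le_mul_right ?_ _)
    have c : ∀ α, AEStronglyMeasurable (pd α (M n)) volume := fun α =>
      ((hMs n).pd α).continuous.aestronglyMeasurable
    calc eLpNorm (fderiv ℝ (M n)) (2 : NNReal) volume
        ≤ eLpNorm (fun x => ∑ α, |pd α (M n) x|) 2 volume :=
          eLpNorm_mono fun x => (norm_fderiv_le_sum_pd _ x).trans (le_abs_self _)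
      _ ≤ ∑ α, eLpNorm (fun x => |pd α (M n) x|) 2 volume := by
          have := eLpNorm_sum_le (μ := volume) (s := Finset.univ)
            (f := fun α x => |pd α (M n) x|) (p := 2) (fun α _ => (c α).norm) one_le_two
          refine le_trans (le_of_eq ?_) this
          congr 1
      _ ≤ ∑ α, eLpNorm (D α) 2 volume := Finset.sum_le_sum fun α _ => by
          have e : eLpNorm (fun x => |pd α (M n) x|) 2 volume = eLpNorm (convolution (D α)
              ((φ n).normed volume) (ContinuousLinearMap.lsmul ℝ ℝ) volume) 2 volume := by
            rw [show (fun x => |pd α (M n) x|) = fun x => ‖pd α (M n) x‖ from rfl, eLpNorm_norm]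
            congr 1
            funext x
            exact pd_convolution (hW α) hχ (hρs n) (hρc n) x
          rw [e]
          exact eLpNorm_convolution_le (hD2 α).1 (φ n).continuous_normed (φ n).nonneg_normed
            (φ n).integrable_normed (φ n).integral_normed
  have hlim : ∀ᵐ x, Filter.Tendsto (fun n => M n x) Filter.atTop (nhds (G x)) := by
    have := ContDiffBump.ae_convolution_tendsto_right_of_locallyIntegrable (μ := volume)
      (φ := φ) (l := Filter.atTop) (K := 2) (g := G) (by
        have h := (tendsto_one_div_add_atTop_nhds_zero_nat (𝕜 := ℝ)).const_mul 2
        rw [mul_zero] at h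
        refine h.congr fun n => ?_
        simp only [φ]; ring) (Filter.Eventually.of_forall fun n => le_of_eq (by
        simp only [φ]; ring)) hGi.locallyIntegrable
    filter_upwards [this] with x hx
    refine hx.congr fun n => ?_
    simp only [M]
    rw [convolution_lsmul, convolution_lsmul_swap]
    exact integral_congr_ae (Filter.Eventually.of_forall fun t => by
      simp only [smul_eq_mul]; ring)
  refine ⟨hGi.1, ?_⟩
  have hfatou := Lp.eLpNorm_lim_le_liminf_eLpNorm (p := 4)
    (fun n => (hMs n).continuous.aestronglyMeasurable) G hlim
  have hle : Filter.liminf (fun n => eLpNorm (M n) 4 volume) Filter.atTop ≤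
      K * ∑ α, eLpNorm (D α) 2 volume := by
    refine Filter.liminf_le_of_le (by isBoundedDefault) fun b hb' => ?_
    obtain ⟨n, hn⟩ := hb'.exists
    exact hn.trans (hb n)
  refine (hfatou.trans hle).trans_lt ?_
  exact ENNReal.mul_lt_top ENNReal.coe_lt_top
    (ENNReal.sum_lt_top.2 fun α _ => (hD2 α).2)

/-- A cutoff that is 1 on the half ball and supported in radius 3/4 removes the localization. -/
lemma MemW12.memL_four_ball {g : E4 → ℝ} (hg : MemW12 B1 g) :
    MemL 4 (Metric.ball 0 (1 / 2)) g := by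
  let χ : ContDiffBump (0 : E4) := ⟨1 / 2, 3 / 4, by norm_num, by norm_num⟩
  have hχ : IsTestFunction B1 χ := ⟨χ.contDiff, χ.hasCompactSupport, by
    rw [χ.tsupport_eq]
    exact Metric.closedBall_subset_ball (by norm_num [χ])⟩
  have h := (hg.memLp_four_mul_testFunction Metric.isOpen_ball hχ).restrict
    (Metric.ball (0 : E4) (1 / 2))
  refine (memLp_congr_ae ?_).1 h
  filter_upwards [ae_restrict_mem Metric.isOpen_ball.measurableSet] with x hx
  rw [χ.one_of_mem_closedBall (Metric.ball_subset_closedBall hx), mul_one]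

/-! ### Rearrangements: L log L ⊂ L¹ and L^{p,1} ⊂ L^p -/

lemma rearrangement_antitone (Ω : Set E4) (g : E4 → ℝ) : Antitone (rearrangement Ω g) :=
  fun _ _ hst => sInf_le_sInf fun _ hr => ⟨hr.1, hr.2.trans (ENNReal.ofReal_le_ofReal hst)⟩

lemma measurable_rearrangement (Ω : Set E4) (g : E4 → ℝ) : Measurable (rearrangement Ω g) :=
  (rearrangement_antitone Ω g).measurable

/-- An admissible level below s would have an even larger superlevel set, which contradicts its
measure bound. -/
lemma le_rearrangement {Ω : Set E4} {g : E4 → ℝ} {s t : ℝ}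
    (h : ENNReal.ofReal t < (volume.restrict Ω) {x | ENNReal.ofReal s < ‖g x‖ₑ}) :
    ENNReal.ofReal s ≤ rearrangement Ω g t := by
  refine le_sInf fun r hr => ?_
  by_contra! hlt
  refine absurd (h.trans_le ((measure_mono fun x (hx : ENNReal.ofReal s < ‖g x‖ₑ) => ?_).trans
    hr.2)) (lt_irrefl _)
  exact hlt.trans hx

/-- The `L¹` norm is at most the integral of the nonincreasing rearrangement. -/
lemma lintegral_enorm_le_lintegral_rearrangement {Ω : Set E4} {g : E4 → ℝ}
    (hg : AEStronglyMeasurable g (volume.restrict Ω)) :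
    ∫⁻ x in Ω, ‖g x‖ₑ ≤ ∫⁻ t in Ioi (0 : ℝ), rearrangement Ω g t := by
  set m : ℝ → ℝ≥0∞ := fun s => (volume.restrict Ω) {x | ENNReal.ofReal s < ‖g x‖ₑ} with hm
  have hma : Antitone m := fun s s' h => measure_mono fun x hx =>
    (ENNReal.ofReal_le_ofReal h).trans_lt hx
  have hmm : Measurable m := hma.measurable
  have hlc : ∫⁻ x in Ω, ‖g x‖ₑ = ∫⁻ s in Ioi (0 : ℝ), m s := by
    have h := lintegral_eq_lintegral_meas_lt (volume.restrict Ω) (f := fun x => |g x|)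
      (Filter.Eventually.of_forall fun x => abs_nonneg _) hg.norm.aemeasurable
    have e : ∀ x, ‖g x‖ₑ = ENNReal.ofReal |g x| := fun x => Real.enorm_eq_ofReal_abs _
    simp_rw [e]
    rw [h]
    refine setLIntegral_congr_fun measurableSet_Ioi fun s hs => ?_
    simp only [hm, e]
    congr 1
    ext x
    exact (ENNReal.ofReal_lt_ofReal_iff_of_nonneg (le_of_lt hs)).symm
  -- After the layer-cake formula, m s is itself written as the length of {t > 0 : t < m s}; Tonelli
  -- exchanges the roles of level and measure.
  have hslice : ∀ s, m s = ∫⁻ t in Ioi (0 : ℝ), {t | ENNReal.ofReal t < m s}.indicator 1 t :=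
    fun s => by
      rw [lintegral_indicator_one (measurableSet_lt ENNReal.measurable_ofReal measurable_const),
        Measure.restrict_apply (measurableSet_lt ENNReal.measurable_ofReal measurable_const)]
      rcases eq_or_ne (m s) ∞ with h | h
      · have : {t : ℝ | ENNReal.ofReal t < m s} ∩ Ioi 0 = Ioi 0 := by
          ext t; simp [h]
        rw [this, h, Real.volume_Ioi]
      · have : {t : ℝ | ENNReal.ofReal t < m s} ∩ Ioi 0 = Ioo 0 (m s).toReal := by
          ext t
          simp only [mem_inter_iff, mem_ofPred_eq, mem_Ioi, mem_Ioo]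
          rw [and_comm]
          refine and_congr_right fun ht => ?_
          rw [← ENNReal.ofReal_toReal h, ENNReal.toReal_ofReal ENNReal.toReal_nonneg]
          exact ENNReal.ofReal_lt_ofReal_iff_of_nonneg ht.le
        rw [this, Real.volume_Ioo, sub_zero, ENNReal.ofReal_toReal h]
  rw [hlc]
  calc ∫⁻ s in Ioi (0 : ℝ), m s
      = ∫⁻ s in Ioi (0 : ℝ), ∫⁻ t in Ioi (0 : ℝ), {t | ENNReal.ofReal t < m s}.indicator 1 t :=
        lintegral_congr fun s => hslice s
    _ = ∫⁻ t in Ioi (0 : ℝ), ∫⁻ s in Ioi (0 : ℝ), {t | ENNReal.ofReal t < m s}.indicator 1 t := by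
        refine lintegral_lintegral_swap (Measurable.aemeasurable ?_)
        have : MeasurableSet {q : ℝ × ℝ | ENNReal.ofReal q.2 < m q.1} :=
          measurableSet_lt (ENNReal.measurable_ofReal.comp measurable_snd)
            (hmm.comp measurable_fst)
        exact (measurable_one.indicator this : Measurable
          ({q : ℝ × ℝ | ENNReal.ofReal q.2 < m q.1}.indicator (1 : ℝ × ℝ → ℝ≥0∞)))
    _ ≤ ∫⁻ t in Ioi (0 : ℝ), rearrangement Ω g t := by
        refine lintegral_mono fun t => ?_
        have hset : MeasurableSet {s : ℝ | ENNReal.ofReal t < m s} :=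
          measurableSet_lt measurable_const hmm
        change ∫⁻ s in Ioi (0 : ℝ), {s | ENNReal.ofReal t < m s}.indicator 1 s ≤ _
        rw [lintegral_indicator_one hset, Measure.restrict_apply hset]
        rcases eq_or_ne (rearrangement Ω g t) ∞ with h | h
        · rw [h]; exact le_top
        · calc volume ({s | ENNReal.ofReal t < m s} ∩ Ioi 0)
              ≤ volume (Icc 0 (rearrangement Ω g t).toReal) := by
                refine measure_mono fun s hs => ⟨le_of_lt hs.2, ?_⟩
                exact (ENNReal.ofReal_le_iff_le_toReal h).1 (le_rearrangement hs.1)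
            _ = rearrangement Ω g t := by
                rw [Real.volume_Icc, sub_zero, ENNReal.ofReal_toReal h]

/-- `L log L ⊂ L¹`. -/
lemma MemLlogL.memL_one {Ω : Set E4} {g : E4 → ℝ} (h : MemLlogL Ω g) : MemL 1 Ω g := by
  refine ⟨h.1, ?_⟩
  rw [eLpNorm_one_eq_lintegral_enorm]
  refine (lintegral_enorm_le_lintegral_rearrangement h.1).trans_lt ?_
  -- The weight log(2 + 1/t) is at least log 2 > 0.
  have hc : 0 < ENNReal.ofReal (Real.log 2) := ENNReal.ofReal_pos.2 (Real.log_pos one_lt_two)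
  have h1 : (∫⁻ t in Ioi (0 : ℝ), rearrangement Ω g t) * ENNReal.ofReal (Real.log 2) < ∞ := by
    rw [← lintegral_mul_const _ (measurable_rearrangement Ω g)]
    refine lt_of_le_of_lt (setLIntegral_mono' measurableSet_Ioi fun t ht => ?_) h.2
    gcongr
    have : 0 ≤ 1 / t := one_div_nonneg.2 (le_of_lt ht)
    linarith
  by_contra htop
  rw [not_lt, top_le_iff] at htop
  rw [htop, ENNReal.top_mul hc.ne'] at h1
  exact lt_irrefl _ h1

/-- The mean of a nonincreasing function over (0, t) is at least its value at t. -/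
lemma rearrangement_le_maximalRearrangement (Ω : Set E4) (g : E4 → ℝ) {t : ℝ} (ht : 0 < t) :
    rearrangement Ω g t ≤ maximalRearrangement Ω g t := by
  rw [maximalRearrangement, ENNReal.le_div_iff_mul_le (Or.inl (ENNReal.ofReal_pos.2 ht).ne')
    (Or.inl ENNReal.ofReal_ne_top)]
  calc rearrangement Ω g t * ENNReal.ofReal t = ∫⁻ _s in Ioo 0 t, rearrangement Ω g t := by
        rw [setLIntegral_const, Real.volume_Ioo, sub_zero]
    _ ≤ ∫⁻ s in Ioo 0 t, rearrangement Ω g s :=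
        setLIntegral_mono' measurableSet_Ioo fun s hs => rearrangement_antitone Ω g hs.2.le

/-- Raising to a positive power is increasing, so an admissible level s for `g` yields the
admissible level s^p for |g|^p. -/
lemma rearrangement_norm_rpow_le (Ω : Set E4) (g : E4 → ℝ) {p : ℝ} (hp : 0 < p) (t : ℝ) :
    rearrangement Ω (fun x => ‖g x‖ ^ p) t ≤ rearrangement Ω g t ^ p := by
  rw [← ENNReal.rpow_inv_le_iff hp]
  refine le_sInf fun s hs => ?_
  rw [ENNReal.rpow_inv_le_iff hp]
  refine sInf_le ⟨?_, ?_⟩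
  · rcases eq_or_ne s ∞ with h | h
    · simp [h, hp]
    · exact ENNReal.rpow_pos hs.1 h
  · refine le_trans (measure_mono fun x hx => ?_) hs.2
    have hx' : s ^ p < ‖‖g x‖ ^ p‖ₑ := hx
    rw [Real.enorm_rpow_of_nonneg (norm_nonneg _) hp.le, enorm_norm] at hx'
    exact (ENNReal.rpow_lt_rpow_iff hp).1 hx'

/-- `L^{p,1} ⊂ L^p`. -/
lemma MemLorentz.memL {Ω : Set E4} {g : E4 → ℝ} {p : ℝ} (hp : 1 < p)
    (h : MemLorentz p 1 Ω g) : MemL (ENNReal.ofReal p) Ω g := by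
  have hp0 : 0 < p := by linarith
  refine ⟨h.1, ?_⟩
  set r := rearrangement Ω g with hr
  set A : ℝ≥0∞ := ∫⁻ t in Ioi (0 : ℝ), ENNReal.ofReal t ^ (1 / p - 1) * r t with hA
  have hAt : A < ∞ := by
    have h2 := h.2
    rw [lorentzNorm, div_one, ENNReal.rpow_one] at h2
    refine lt_of_le_of_lt (setLIntegral_mono' measurableSet_Ioi fun t ht => ?_) h2
    have ht0 : ENNReal.ofReal t ≠ 0 := (ENNReal.ofReal_pos.2 ht).ne'
    rw [ENNReal.rpow_one, ENNReal.rpow_sub _ _ ht0 ENNReal.ofReal_ne_top, ENNReal.rpow_one,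
      ENNReal.mul_div_right_comm]
    gcongr
    exact rearrangement_le_maximalRearrangement Ω g ht
  -- the pointwise bound `t^{1/p} g^*(t) ≤ A`
  have hpt : ∀ t : ℝ, 0 < t → ENNReal.ofReal t ^ (1 / p) * r t ≤ A := fun t ht => by
    have ht0 : ENNReal.ofReal t ≠ 0 := (ENNReal.ofReal_pos.2 ht).ne'
    calc ENNReal.ofReal t ^ (1 / p) * r t
        = ∫⁻ _s in Ioo 0 t, ENNReal.ofReal t ^ (1 / p - 1) * r t := by
          rw [setLIntegral_const, Real.volume_Ioo, sub_zero,
            ENNReal.rpow_sub _ _ ht0 ENNReal.ofReal_ne_top, ENNReal.rpow_one,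
            mul_right_comm, ENNReal.div_mul_cancel ht0 ENNReal.ofReal_ne_top]
      _ ≤ ∫⁻ s in Ioo 0 t, ENNReal.ofReal s ^ (1 / p - 1) * r s := by
          refine setLIntegral_mono' measurableSet_Ioo fun s hs => ?_
          refine mul_le_mul' ?_ (rearrangement_antitone Ω g hs.2.le)
          -- The exponent 1/p - 1 is negative, so the power of s also decreases.
          rw [← neg_sub, ENNReal.rpow_neg, ENNReal.rpow_neg, ENNReal.inv_le_inv]
          refine ENNReal.rpow_le_rpow (ENNReal.ofReal_le_ofReal hs.2.le) ?_
          rw [sub_nonneg, div_le_one hp0]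
          exact hp.le
      _ ≤ A := lintegral_mono_set fun s hs => hs.1
  -- Split r^p = (t^{1/p} r)^{p-1} · t^{1/p-1} r, as (p-1)/p = 1 - 1/p. The first factor is at most
  -- A^{p-1}, and the second integrates to A.
  have hle : ∫⁻ t in Ioi (0 : ℝ), r t ^ p ≤ A ^ (p - 1) * A := by
    rw [hA, ← lintegral_const_mul' _ _ (ENNReal.rpow_ne_top_of_nonneg (by linarith) hAt.ne)]
    refine setLIntegral_mono' measurableSet_Ioi fun t ht => ?_
    have ht0 : ENNReal.ofReal t ≠ 0 := (ENNReal.ofReal_pos.2 ht).ne'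
    have htt : ENNReal.ofReal t ≠ ∞ := ENNReal.ofReal_ne_top
    have h1 := ENNReal.rpow_le_rpow (hpt t ht) (by linarith : 0 ≤ p - 1)
    rw [ENNReal.mul_rpow_of_nonneg _ _ (by linarith), ← ENNReal.rpow_mul] at h1
    have e : (1 / p - 1) = -(1 / p * (p - 1)) := by field_simp; ring
    calc r t ^ p = r t ^ (p - 1) * r t := by
          have := ENNReal.rpow_add_of_nonneg (x := r t) (p - 1) 1 (by linarith) zero_le_one
          rwa [sub_add_cancel, ENNReal.rpow_one] at this
      _ = (ENNReal.ofReal t ^ (1 / p * (p - 1)) * r t ^ (p - 1)) *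
          (ENNReal.ofReal t ^ (1 / p - 1) * r t) := by
          rw [e, ENNReal.rpow_neg]
          have := ENNReal.mul_inv_cancel (a := ENNReal.ofReal t ^ (1 / p * (p - 1))) (by
            simp [ht0, htt]) (ENNReal.rpow_ne_top_of_nonneg (by
              have : 0 < 1 / p := by positivity
              nlinarith) htt)
          rw [mul_mul_mul_comm, this, one_mul]
      _ ≤ A ^ (p - 1) * (ENNReal.ofReal t ^ (1 / p - 1) * r t) := by gcongr
  rw [eLpNorm_lt_top_iff_lintegral_rpow_enorm_lt_top (by simp [hp0]) (by simp),
    ENNReal.toReal_ofReal hp0.le]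
  have e : ∀ x, ‖g x‖ₑ ^ p = ‖‖g x‖ ^ p‖ₑ := fun x => by
    rw [Real.enorm_rpow_of_nonneg (norm_nonneg _) hp0.le, enorm_norm]
  simp_rw [e]
  refine (lintegral_enorm_le_lintegral_rearrangement
    (h.1.norm.aemeasurable.pow_const p).aestronglyMeasurable).trans_lt ?_
  refine (lintegral_mono fun t => rearrangement_norm_rpow_le Ω g hp0 t).trans_lt ?_
  exact hle.trans_lt (ENNReal.mul_lt_top (ENNReal.rpow_lt_top_of_nonneg (by linarith) hAt.ne) hAt)

/-! ### Cutoffs around the origin -/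

lemma pd_comp_smul {η : E4 → ℝ} (hη : IsSmooth η) (R : ℝ) (α : Fin 4) :
    pd α (fun x => η (R • x)) = fun x => R * pd α η (R • x) := by
  funext x
  have h1 : HasFDerivAt (fun s : E4 => R • s) (R • ContinuousLinearMap.id ℝ E4) x :=
    (hasFDerivAt_id x).const_smul R
  have h2 := (hη.differentiable (R • x)).hasFDerivAt.comp x h1
  simp only [pd]
  rw [show (fun s => η (R • s)) = η ∘ fun s => R • s from rfl, h2.fderiv]
  simp

lemma pd_const_mul {η : E4 → ℝ} (hη : IsSmooth η) (R : ℝ) (α : Fin 4) :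
    pd α (fun x => R * η x) = fun x => R * pd α η x := by
  funext x
  simp only [pd]
  rw [fderiv_const_mul hη.differentiable.differentiableAt]
  simp

lemma pd_one_sub {η : E4 → ℝ} (α : Fin 4) :
    pd α (fun x => 1 - η x) = fun x => -pd α η x := by
  funext x
  simp only [pd, fderiv_const_sub]
  simp

/-- Smooth functions that vanish near the origin and equal `1` outside the ball of radius `1 / R`,
with scale-invariant bounds. -/
lemma exists_cutoff : ∃ C : ℝ, ∀ R : ℝ, 1 ≤ R → ∃ η : E4 → ℝ,
    IsBddSmooth (C * R ^ 2) η ∧ (0 : E4) ∉ tsupport η ∧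
    (∀ x, |1 - η x| ≤ C) ∧ (∀ α x, |pd α η x| ≤ C * R) ∧
    ∀ x ∉ Metric.ball (0 : E4) (1 / R), 1 - η x = 0 ∧ ∀ α, pd α η x = 0 ∧
      ∀ β, pd β (pd α η) x = 0 := by
  -- The cutoff is 1 - b(R x): zero for |x| ≤ 1/(4R) and one for |x| ≥ 1/(2R).
  let b : ContDiffBump (0 : E4) := ⟨1 / 4, 1 / 2, by norm_num, by norm_num⟩
  have hb : IsTestFunction univ b := ⟨b.contDiff, b.hasCompactSupport, subset_univ _⟩
  have hbdd : ∀ ψ : E4 → ℝ, IsTestFunction univ ψ → ∃ C, ∀ x, |ψ x| ≤ C := fun ψ hψ =>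
    hψ.1.continuous.bounded_above_of_compact_support hψ.2.1
  obtain ⟨C0, h0⟩ := hbdd b hb
  choose C1 h1 using fun α => hbdd _ (hb.pd α)
  choose C2 h2 using fun β α => hbdd _ ((hb.pd α).pd β)
  have p0 : 0 ≤ C0 := (abs_nonneg _).trans (h0 0)
  have p1 : ∀ α, 0 ≤ C1 α := fun α => (abs_nonneg _).trans (h1 α 0)
  have p2 : ∀ β α, 0 ≤ C2 β α := fun β α => (abs_nonneg _).trans (h2 β α 0)
  set S1 := ∑ α, C1 α with hS1
  set S2 := ∑ β, ∑ α, C2 β α with hS2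
  have q1 : ∀ α, C1 α ≤ S1 := fun α =>
    Finset.single_le_sum (fun α _ => p1 α) (Finset.mem_univ α)
  have q2 : ∀ β α, C2 β α ≤ S2 := fun β α =>
    (Finset.single_le_sum (f := C2 β) (fun α _ => p2 β α) (Finset.mem_univ α)).trans
      (Finset.single_le_sum (f := fun β => ∑ α, C2 β α)
        (fun β _ => Finset.sum_nonneg fun α _ => p2 β α) (Finset.mem_univ β))
  have hS1n : 0 ≤ S1 := Finset.sum_nonneg fun α _ => p1 α
  have hS2n : 0 ≤ S2 := Finset.sum_nonneg fun β _ => Finset.sum_nonneg fun α _ => p2 β α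
  -- One constant dominates all orders; as R ≥ 1, the bounds of order R⁰ and R¹ are absorbed in R².
  refine ⟨1 + C0 + S1 + S2, fun R hR => ?_⟩
  have hR0 : 0 < R := by linarith
  have hRR : R ≤ R ^ 2 := by nlinarith
  have hR1 : 1 ≤ R ^ 2 := by nlinarith
  set θ : E4 → ℝ := fun x => b (R • x) with hθ
  have hθs : IsSmooth θ := hb.isSmooth.comp (contDiff_const_smul R)
  have d1 : ∀ α, pd α (fun x => 1 - θ x) = fun x => -(R * pd α b (R • x)) := fun α => by
    rw [pd_one_sub, hθ, pd_comp_smul hb.isSmooth]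
  have d2 : ∀ β α, pd β (pd α (fun x => 1 - θ x)) =
      fun x => -(R * (R * pd β (pd α b) (R • x))) := fun β α => by
    have e : pd α (fun x => 1 - θ x) = fun x => (-R) * pd α b (R • x) := by
      rw [d1]; funext x; ring
    have s : IsSmooth fun x : E4 => pd α b (R • x) :=
      (hb.isSmooth.pd α).comp (contDiff_const_smul R)
    rw [e, pd_const_mul s, pd_comp_smul (hb.isSmooth.pd α)]
    funext x; ring
  have z : ∀ x ∉ Metric.ball (0 : E4) (1 / R), R • x ∉ tsupport b := fun x hx hx' => by
    rw [b.tsupport_eq, Metric.mem_closedBall, dist_zero_right, norm_smul, Real.norm_of_nonneg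
      hR0.le] at hx'
    apply hx
    rw [Metric.mem_ball, dist_zero_right, lt_div_iff₀ hR0]
    have : R * ‖x‖ ≤ 1 / 2 := hx'
    linarith
  refine ⟨fun x => 1 - θ x, ⟨contDiff_const.sub hθs, fun x => ?_, fun α x => ?_,
    fun β α x => ?_⟩, ?_, fun x => ?_, fun α x => ?_, fun x hx => ?_⟩
  · have h := h0 (R • x)
    have t : |1 - θ x| ≤ 1 + |θ x| := by
      simpa using abs_sub (1 : ℝ) (θ x)
    have h' : |θ x| ≤ C0 := h
    nlinarith
  · rw [d1, abs_neg, abs_mul, abs_of_pos hR0]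
    have h := (h1 α (R • x)).trans (q1 α)
    nlinarith
  · rw [d2, abs_neg, abs_mul, abs_mul, abs_of_pos hR0]
    have h := (h2 β α (R • x)).trans (q2 β α)
    nlinarith
  · rw [notMem_tsupport_iff_eventuallyEq]
    have h : ∀ᶠ x in nhds (0 : E4), R • x ∈ Metric.ball (0 : E4) (1 / 4) := by
      have hc : Continuous fun x : E4 => R • x := continuous_const_smul R
      exact hc.continuousAt.eventually_mem (Metric.isOpen_ball.mem_nhds (by simp))
    filter_upwards [h] with x hx
    simp [hθ, b.one_of_mem_closedBall (Metric.ball_subset_closedBall hx)]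
  · have h : |θ x| ≤ C0 := h0 (R • x)
    rw [sub_sub_cancel]
    linarith
  · rw [d1, abs_neg, abs_mul, abs_of_pos hR0]
    have h := (h1 α (R • x)).trans (q1 α)
    nlinarith
  · have hz := z x hx
    refine ⟨?_, fun α => ⟨?_, fun β => ?_⟩⟩
    · rw [sub_sub_cancel]
      exact image_eq_zero_of_notMem_tsupport (f := b) hz
    · simp only [d1]
      rw [image_eq_zero_of_notMem_tsupport (fun h => hz (tsupport_pd_subset _ _ h))]
      simp
    · simp only [d2]
      rw [image_eq_zero_of_notMem_tsupport
        (fun h => hz (tsupport_pd_subset _ _ (tsupport_pd_subset _ _ h)))]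
      simp

/-! ### Error terms that vanish in L¹ -/

/-- A sequence of functions that tends to `0` in `L¹(B₁)`. -/
def VanishesInL1 (D : ℕ → E4 → ℝ) : Prop :=
  (∀ k, Integrable (D k) (volume.restrict B1)) ∧
    Filter.Tendsto (fun k => ∫ x in B1, ‖D k x‖) Filter.atTop (nhds 0)

lemma VanishesInL1.add {D D' : ℕ → E4 → ℝ} (h : VanishesInL1 D) (h' : VanishesInL1 D') :
    VanishesInL1 (fun k x => D k x + D' k x) := by
  refine ⟨fun k => (h.1 k).add (h'.1 k), ?_⟩
  have := h.2.add h'.2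
  rw [add_zero] at this
  refine squeeze_zero (fun k => integral_nonneg fun x => norm_nonneg _) (fun k => ?_) this
  rw [← integral_add (h.1 k).norm (h'.1 k).norm]
  exact integral_mono ((h.1 k).add (h'.1 k)).norm ((h.1 k).norm.add (h'.1 k).norm)
    fun x => norm_add_le _ _

lemma VanishesInL1.zero : VanishesInL1 (fun _ _ => 0) :=
  ⟨fun _ => integrable_zero _ _ _, by simp⟩

lemma VanishesInL1.sum {ι : Type*} {s : Finset ι} {D : ι → ℕ → E4 → ℝ}
    (h : ∀ i, VanishesInL1 (D i)) : VanishesInL1 (fun k x => ∑ i ∈ s, D i k x) := by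
  classical
  induction s using Finset.induction_on with
  | empty => simpa using VanishesInL1.zero
  | insert a s ha ih => simpa only [Finset.sum_insert ha] using (h a).add ih

/-- If the difference of two functions is integrable, then so are both functions or none, and
their integrals differ by at most the `L¹` norm of the difference. It lets us compare the integrals
of two functions that differ only near the origin without an integrability estimate up to the
boundary of `B₁`. -/
lemma norm_integral_sub_integral_le {μ : Measure E4} {f g : E4 → ℝ}
    (h : Integrable (fun x => f x - g x) μ) :
    ‖∫ x, f x ∂μ - ∫ x, g x ∂μ‖ ≤ ∫ x, ‖f x - g x‖ ∂μ := by
  by_cases hf : Integrable f μ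
  · have hg : Integrable g μ := by
      have := hf.sub h
      refine this.congr (Filter.Eventually.of_forall fun x => ?_)
      simp
    rw [← integral_sub hf hg]
    exact norm_integral_le_integral_norm _
  · have hg : ¬ Integrable g μ := fun hg => hf (by
      refine (hg.add h).congr (Filter.Eventually.of_forall fun x => ?_)
      simp)
    rw [integral_undef hf, integral_undef hg, sub_zero, norm_zero]
    exact integral_nonneg fun x => norm_nonneg _

/-- The limit integrand need not be integrable: if it is not, neither is any member of the sequence,
and all the integrals are 0 by convention. -/
lemma VanishesInL1.tendsto_integral {D E : ℕ → E4 → ℝ} {e : E4 → ℝ} (h : VanishesInL1 D)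
    (hD : ∀ k, (fun x => E k x - e x) =ᵐ[volume.restrict B1] D k) :
    Filter.Tendsto (fun k => ∫ x in B1, E k x) Filter.atTop (nhds (∫ x in B1, e x)) := by
  rw [tendsto_iff_norm_sub_tendsto_zero]
  refine squeeze_zero (fun k => norm_nonneg _) (fun k => ?_) h.2
  refine (norm_integral_sub_integral_le ((h.1 k).congr (hD k).symm)).trans (le_of_eq ?_)
  exact integral_congr_ae (by filter_upwards [hD k] with x hx; rw [hx])

lemma volume_ball_one_div {R : ℝ} (hR : 0 < R) :
    volume (Metric.ball (0 : E4) (1 / R)) = ENNReal.ofReal R⁻¹ ^ 4 * volume B1 := by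
  rw [Measure.addHaar_ball _ _ (by positivity), finrank_euclideanSpace, Fintype.card_fin, one_div,
    ENNReal.ofReal_pow (by positivity)]
  rfl

/-- A function in `L^p` near the origin, multiplied by a sequence that is bounded by
`C (k + 2)^m` and supported in the balls of radius `1 / (k + 2)`, vanishes in `L¹` in the
scale-invariant case `m = 4 (1 - 1 / p)`. -/
lemma vanishesInL1_mul {p : ℝ} (hp : 1 ≤ p) {m : ℕ} (hm : (m : ℝ) = 4 * (1 - 1 / p))
    {A : E4 → ℝ} (hA : MemL (ENNReal.ofReal p) (Metric.ball 0 (1 / 2)) A)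
    {κ : ℕ → E4 → ℝ} {C : ℝ} (hc : ∀ k, Continuous (κ k))
    (hb : ∀ k x, |κ k x| ≤ C * ((k : ℝ) + 2) ^ m)
    (hs : ∀ k : ℕ, ∀ x ∉ Metric.ball (0 : E4) (1 / ((k : ℝ) + 2)), κ k x = 0) :
    VanishesInL1 (fun k x => A x * κ k x) := by
  set B : ℕ → Set E4 := fun k => Metric.ball (0 : E4) (1 / ((k : ℝ) + 2)) with hBdef
  have hBm : ∀ k, MeasurableSet (B k) := fun k => Metric.isOpen_ball.measurableSet
  have hB2 : ∀ k, B k ⊆ Metric.ball 0 (1 / 2) := fun k =>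
    Metric.ball_subset_ball (one_div_le_one_div_of_le two_pos (by
      have : (0 : ℝ) ≤ k := k.cast_nonneg
      linarith))
  have hp0 : 0 < p := by linarith
  have hpe : (1 : ℝ≥0∞) ≤ ENNReal.ofReal p := by simpa using ENNReal.ofReal_le_ofReal hp
  have hfin : IsFiniteMeasure (volume.restrict (Metric.ball (0 : E4) (1 / 2))) :=
    ⟨by simpa using measure_ball_lt_top⟩
  have hA1 : IntegrableOn A (Metric.ball 0 (1 / 2)) volume :=
    memLp_one_iff_integrable.1 (hA.mono_exponent hpe)
  have hAB : ∀ k, IntegrableOn A (B k) volume := fun k => hA1.mono_set (hB2 k)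
  have hprod : ∀ k, IntegrableOn (fun x => A x * κ k x) (B k) volume := fun k =>
    (hAB k).mul_bdd (hc k).aestronglyMeasurable (Filter.Eventually.of_forall fun x => hb k x)
  have hsupp : ∀ k, Function.support (fun x => A x * κ k x) ⊆ B k := fun k x hx => by
    by_contra h
    exact hx (by simp [hs k x h])
  have hint : ∀ k, Integrable (fun x => A x * κ k x) volume := fun k =>
    (integrableOn_iff_integrable_of_support_subset (hsupp k)).1 (hprod k)
  refine ⟨fun k => (hint k).restrict, ?_⟩
  have hV : volume B1 ≠ ∞ := measure_ball_lt_top.ne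
  have hq : 0 ≤ 1 - 1 / p := by
    rw [sub_nonneg, div_le_one hp0]; exact hp
  -- Hölder's inequality on the small balls
  have hbound : ∀ k, ∫⁻ x in B1, ‖A x * κ k x‖ₑ ≤ ENNReal.ofReal C * volume B1 ^ (1 - 1 / p) *
      eLpNorm A (ENNReal.ofReal p) (volume.restrict (B k)) := fun k => by
    have hR : (0 : ℝ) < (k : ℝ) + 2 := by positivity
    set R : ℝ := (k : ℝ) + 2 with hRdef
    have hC : 0 ≤ C * R ^ m := (abs_nonneg _).trans (hb k 0)
    have hC' : 0 ≤ C := nonneg_of_mul_nonneg_left hC (by positivity)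
    -- The growth R^m exactly cancels the Hölder factor, a ball volume of order R^{-4} to the power
    -- 1 - 1/p.
    have hRm : ENNReal.ofReal R ^ m * (ENNReal.ofReal R⁻¹ ^ 4) ^ (1 - 1 / p) = 1 := by
      rw [← ENNReal.rpow_natCast (ENNReal.ofReal R⁻¹), ← ENNReal.rpow_mul]
      have : ((4 : ℕ) : ℝ) * (1 - 1 / p) = (m : ℝ) := by rw [hm]; norm_num
      rw [this, ENNReal.rpow_natCast, ← mul_pow, ← ENNReal.ofReal_mul hR.le,
        mul_inv_cancel₀ hR.ne', ENNReal.ofReal_one, one_pow]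
    calc ∫⁻ x in B1, ‖A x * κ k x‖ₑ
        ≤ ∫⁻ x, ‖A x * κ k x‖ₑ := setLIntegral_le_lintegral _ _
      _ = ∫⁻ x in B k, ‖A x * κ k x‖ₑ := by
          rw [← lintegral_indicator (hBm k)]
          refine lintegral_congr fun x => ?_
          by_cases hx : x ∈ B k
          · rw [indicator_of_mem hx]
          · rw [indicator_of_notMem hx, hs k x hx, mul_zero, enorm_zero]
      _ ≤ ∫⁻ x in B k, ENNReal.ofReal (C * R ^ m) * ‖A x‖ₑ := lintegral_mono fun x => by
          rw [enorm_mul, mul_comm]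
          gcongr
          rw [Real.enorm_eq_ofReal_abs]
          exact ENNReal.ofReal_le_ofReal (hb k x)
      _ = ENNReal.ofReal (C * R ^ m) * eLpNorm A 1 (volume.restrict (B k)) := by
          rw [lintegral_const_mul' _ _ ENNReal.ofReal_ne_top, eLpNorm_one_eq_lintegral_enorm]
      _ ≤ ENNReal.ofReal (C * R ^ m) * (eLpNorm A (ENNReal.ofReal p) (volume.restrict (B k)) *
            volume (B k) ^ (1 - 1 / p)) := by
          gcongr
          have := eLpNorm_le_eLpNorm_mul_rpow_measure_univ hpe (hAB k).1
          rwa [Measure.restrict_apply_univ, ENNReal.toReal_one, ENNReal.toReal_ofReal hp0.le,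
            div_one] at this
      _ = ENNReal.ofReal C * volume B1 ^ (1 - 1 / p) *
            eLpNorm A (ENNReal.ofReal p) (volume.restrict (B k)) *
            (ENNReal.ofReal R ^ m * (ENNReal.ofReal R⁻¹ ^ 4) ^ (1 - 1 / p)) := by
          rw [hBdef, volume_ball_one_div hR, ENNReal.mul_rpow_of_nonneg _ _ hq,
            ENNReal.ofReal_mul hC', ENNReal.ofReal_pow hR.le]
          ring
      _ = _ := by rw [hRm, mul_one]
  have hvol : Filter.Tendsto (fun k => volume (B k)) Filter.atTop (nhds 0) := by
    have h1 : Filter.Tendsto (fun k : ℕ => ((k : ℝ) + 2)⁻¹) Filter.atTop (nhds 0) :=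
      (Filter.tendsto_atTop_add_const_right _ _ tendsto_natCast_atTop_atTop).inv_tendsto_atTop
    have h2 := ENNReal.Tendsto.mul_const (b := volume B1)
      (ENNReal.Tendsto.pow (n := 4) (ENNReal.tendsto_ofReal h1)) (Or.inr hV)
    rw [ENNReal.ofReal_zero, zero_pow four_ne_zero, zero_mul] at h2
    exact h2.congr fun k => (volume_ball_one_div (by positivity)).symm
  -- With nothing gained from scaling, the decay comes from absolute continuity of the integral of
  -- |A|^p.
  have hnorm : Filter.Tendsto (fun k => eLpNorm A (ENNReal.ofReal p) (volume.restrict (B k)))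
      Filter.atTop (nhds 0) := by
    have hi := (eLpNorm_lt_top_iff_lintegral_rpow_enorm_lt_top (by simp [hp0]) (by simp)).1 hA.2
    have h1 := tendsto_setLIntegral_zero hi.ne (s := B) (l := Filter.atTop) (by
      refine hvol.congr fun k => ?_
      rw [Function.comp_apply, Measure.restrict_apply (hBm k), inter_eq_left.2 (hB2 k)])
    have h2 := (h1.ennrpow_const (1 / p))
    rw [ENNReal.zero_rpow_of_pos (by positivity)] at h2
    refine h2.congr fun k => ?_
    rw [eLpNorm_eq_lintegral_rpow_enorm_toReal (by simp [hp0]) (by simp),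
      ENNReal.toReal_ofReal hp0.le, Measure.restrict_restrict (hBm k), inter_eq_left.2 (hB2 k)]
  have hlim : Filter.Tendsto (fun k => ∫⁻ x in B1, ‖A x * κ k x‖ₑ) Filter.atTop (nhds 0) := by
    have := ENNReal.Tendsto.const_mul (a := ENNReal.ofReal C * volume B1 ^ (1 - 1 / p)) hnorm
      (Or.inr (ENNReal.mul_ne_top ENNReal.ofReal_ne_top (ENNReal.rpow_ne_top_of_nonneg hq hV)))
    rw [mul_zero] at this
    exact tendsto_of_tendsto_of_tendsto_of_le_of_le tendsto_const_nhds this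
      (fun _ => zero_le) hbound
  have := (ENNReal.tendsto_toReal ENNReal.zero_ne_top).comp hlim
  rw [ENNReal.toReal_zero] at this
  refine this.congr fun k => ?_
  rw [integral_norm_eq_lintegral_enorm (hint k).restrict.1]
  rfl

/-! ### Integrability of the coefficients in the weak formulation -/

/-- The factor of `∂_β φⁱ` on the right-hand side of the weak formulation. -/
def gradCoeff {n : ℕ} (Ω : Set E4) (c : Coefficients n) (u : Fin n → E4 → ℝ) (i : Fin n)
    (β : Fin 4) (x : E4) : ℝ :=
  -(∑ j, ∑ α, (weakDeriv Ω β (fun y => c.V α y i j) x * weakDeriv Ω α (u j) x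
      + c.V α x i j * weakDeriv₂ Ω β α (u j) x))
    - (∑ j, c.w x i j * weakDeriv Ω β (u j) x)
    - ∑ j, c.ω x i j * weakDeriv Ω β (u j) x

/-- The factor of `φⁱ` on the right-hand side of the weak formulation. -/
def valCoeff {n : ℕ} (Ω : Set E4) (c : Coefficients n) (u : Fin n → E4 → ℝ) (i : Fin n)
    (x : E4) : ℝ :=
  -(∑ j, ∑ α, c.ω x i j * weakDeriv₂ Ω α α (u j) x)
    + (∑ j, ∑ α, c.F α x i j * weakDeriv Ω α (u j) x) + c.f i x

/-- Collecting terms by the order of the derivative on φ leaves only two integrability questions.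
The ω-term contributes to both groups. -/
lemma rhs_eq_sum_coeff {n : ℕ} (Ω : Set E4) (c : Coefficients n) (u φ : Fin n → E4 → ℝ)
    (x : E4) :
    (- (∑ i, ∑ j, ∑ α, ∑ β,
              (weakDeriv Ω β (fun y => c.V α y i j) x * weakDeriv Ω α (u j) x
                + c.V α x i j * weakDeriv₂ Ω β α (u j) x) * weakDeriv Ω β (φ i) x)
          - (∑ i, ∑ j, ∑ α, c.w x i j * weakDeriv Ω α (u j) x * weakDeriv Ω α (φ i) x)
          - (∑ i, ∑ j, ∑ α, c.ω x i j *
              (weakDeriv₂ Ω α α (u j) x * φ i x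
                + weakDeriv Ω α (u j) x * weakDeriv Ω α (φ i) x))
          + (∑ i, ∑ j, ∑ α, c.F α x i j * weakDeriv Ω α (u j) x * φ i x)
          + ∑ i, c.f i x * φ i x) =
      ∑ i, (∑ β, gradCoeff Ω c u i β x * weakDeriv Ω β (φ i) x + valCoeff Ω c u i x * φ i x) := by
  have t1 : ∀ i, ∑ j, ∑ α, ∑ β,
      (weakDeriv Ω β (fun y => c.V α y i j) x * weakDeriv Ω α (u j) x
        + c.V α x i j * weakDeriv₂ Ω β α (u j) x) * weakDeriv Ω β (φ i) x =
      ∑ β, (∑ j, ∑ α, (weakDeriv Ω β (fun y => c.V α y i j) x * weakDeriv Ω α (u j) x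
        + c.V α x i j * weakDeriv₂ Ω β α (u j) x)) * weakDeriv Ω β (φ i) x := fun i => by
    simp_rw [Finset.sum_mul]
    rw [Finset.sum_comm (s := (Finset.univ : Finset (Fin 4)))]
    exact Finset.sum_congr rfl fun j _ => Finset.sum_comm
  have t2 : ∀ i, ∑ j, ∑ α, c.w x i j * weakDeriv Ω α (u j) x * weakDeriv Ω α (φ i) x =
      ∑ β, (∑ j, c.w x i j * weakDeriv Ω β (u j) x) * weakDeriv Ω β (φ i) x := fun i => by
    simp_rw [Finset.sum_mul]
    exact Finset.sum_comm
  have t3 : ∀ i, ∑ j, ∑ α, c.ω x i j * (weakDeriv₂ Ω α α (u j) x * φ i x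
        + weakDeriv Ω α (u j) x * weakDeriv Ω α (φ i) x) =
      (∑ j, ∑ α, c.ω x i j * weakDeriv₂ Ω α α (u j) x) * φ i x +
      ∑ β, (∑ j, c.ω x i j * weakDeriv Ω β (u j) x) * weakDeriv Ω β (φ i) x := fun i => by
    simp_rw [mul_add, Finset.sum_add_distrib, Finset.sum_mul, mul_assoc]
    congr 1
    exact Finset.sum_comm
  have t4 : ∀ i, ∑ j, ∑ α, c.F α x i j * weakDeriv Ω α (u j) x * φ i x =
      (∑ j, ∑ α, c.F α x i j * weakDeriv Ω α (u j) x) * φ i x := fun i => by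
    simp_rw [Finset.sum_mul]
  simp_rw [t1, t2, t3, t4, gradCoeff, valCoeff, add_mul, sub_mul, neg_mul,
    Finset.sum_add_distrib, Finset.sum_sub_distrib, Finset.sum_neg_distrib]
  ring

instance holderTriple_two_four : ENNReal.HolderTriple 2 4 (ENNReal.ofReal (4 / 3)) where
  inv_add_inv_eq_inv := by
    rw [← ENNReal.ofReal_inv_of_pos (by norm_num),
      show (2 : ℝ≥0∞) = ENNReal.ofReal 2 by simp, show (4 : ℝ≥0∞) = ENNReal.ofReal 4 by simp,
      ← ENNReal.ofReal_inv_of_pos (by norm_num), ← ENNReal.ofReal_inv_of_pos (by norm_num),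
      ← ENNReal.ofReal_add (by norm_num) (by norm_num)]
    norm_num

instance holderTriple_four_two : ENNReal.HolderTriple 4 2 (ENNReal.ofReal (4 / 3)) :=
  holderTriple_two_four.symm

instance holderTriple_fourThirds_four : ENNReal.HolderTriple (ENNReal.ofReal (4 / 3)) 4 1 where
  inv_add_inv_eq_inv := by
    rw [← ENNReal.ofReal_inv_of_pos (by norm_num), show (4 : ℝ≥0∞) = ENNReal.ofReal 4 by simp,
      ← ENNReal.ofReal_inv_of_pos (by norm_num),
      ← ENNReal.ofReal_add (by norm_num) (by norm_num)]
    norm_num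

lemma MemL.mul {p q r : ℝ≥0∞} [ENNReal.HolderTriple p q r] {Ω : Set E4} {f g : E4 → ℝ}
    (hf : MemL p Ω f) (hg : MemL q Ω g) : MemL r Ω (fun x => f x * g x) :=
  MemLp.mul' (p := p) (q := q) hg hf

lemma ball_half_subset_B1 : Metric.ball (0 : E4) (1 / 2) ⊆ B1 :=
  Metric.ball_subset_ball (by norm_num)

lemma isOpen_B1 : IsOpen B1 := Metric.isOpen_ball

lemma restrict_B1_diff_singleton :
    (volume : Measure E4).restrict (B1 \ {0}) = volume.restrict B1 :=
  Measure.restrict_congr_set (sdiff_null_ae_eq_self (measure_singleton _))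

lemma Coefficients.Admissible.f_memL_one {n : ℕ} {c : Coefficients n} (hc : c.Admissible B1)
    (i : Fin n) : MemL 1 B1 (c.f i) := by
  rcases hc.f_mem with ⟨p, hp, h⟩ | h
  · have : IsFiniteMeasure (volume.restrict B1) := ⟨by
      rw [Measure.restrict_apply_univ]
      exact measure_ball_lt_top⟩
    exact MemLp.mono_exponent (h i) hp.le
  · exact (h i).memL_one

/-- Each summand is a product of an L² and an L⁴ function, and 1/2 + 1/4 = 3/4. The L⁴ bounds on V
and ∇u are interior, hence the half ball. -/
lemma gradCoeff_memL {n : ℕ} {c : Coefficients n} (hc : c.Admissible B1) {u : Fin n → E4 → ℝ}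
    (hu : ∀ i, MemW22 B1 (u i)) (i : Fin n) (β : Fin 4) :
    MemL (ENNReal.ofReal (4 / 3)) (Metric.ball 0 (1 / 2)) (gradCoeff B1 c u i β) := by
  have hs := ball_half_subset_B1
  have du4 : ∀ j α, MemL 4 (Metric.ball 0 (1 / 2)) (weakDeriv B1 α (u j)) := fun j α =>
    ((hu j).2 α).2.memL_four_ball
  have h1 : ∀ j α, MemL (ENNReal.ofReal (4 / 3)) (Metric.ball 0 (1 / 2))
      (fun x => weakDeriv B1 β (fun y => c.V α y i j) x * weakDeriv B1 α (u j) x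
        + c.V α x i j * weakDeriv₂ B1 β α (u j) x) := fun j α =>
    MemLp.add ((((hc.V_mem α i j).2 β).2.mono_set hs).mul (du4 j α))
      ((hc.V_mem α i j).memL_four_ball.mul (((hu j).memL_weakDeriv₂ β α).mono_set hs))
  have h2 : ∀ j, MemL (ENNReal.ofReal (4 / 3)) (Metric.ball 0 (1 / 2))
      (fun x => c.w x i j * weakDeriv B1 β (u j) x) := fun j =>
    ((hc.w_mem i j).mono_set hs).mul (du4 j β)
  have h3 : ∀ j, MemL (ENNReal.ofReal (4 / 3)) (Metric.ball 0 (1 / 2))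
      (fun x => c.ω x i j * weakDeriv B1 β (u j) x) := fun j =>
    ((hc.ω_mem i j).mono_set hs).mul (du4 j β)
  exact MemLp.sub (MemLp.sub (MemLp.neg (memLp_finsetSum _ fun j _ =>
    memLp_finsetSum _ fun α _ => h1 j α)) (memLp_finsetSum _ fun j _ => h2 j))
    (memLp_finsetSum _ fun j _ => h3 j)

/-- The ω-term pairs L² with L², the F-term pairs L^{4/3} with L⁴, and f is in L¹ under either
assumption on it. -/
lemma valCoeff_memL {n : ℕ} {c : Coefficients n} (hc : c.Admissible B1) {u : Fin n → E4 → ℝ}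
    (hu : ∀ i, MemW22 B1 (u i)) (i : Fin n) :
    MemL 1 (Metric.ball 0 (1 / 2)) (valCoeff B1 c u i) := by
  have hs := ball_half_subset_B1
  have h1 : ∀ j α, MemL 1 (Metric.ball 0 (1 / 2))
      (fun x => c.ω x i j * weakDeriv₂ B1 α α (u j) x) := fun j α =>
    ((hc.ω_mem i j).mono_set hs).mul (((hu j).memL_weakDeriv₂ α α).mono_set hs)
  have h2 : ∀ j α, MemL 1 (Metric.ball 0 (1 / 2))
      (fun x => c.F α x i j * weakDeriv B1 α (u j) x) := fun j α =>
    (((hc.F_mem α i j).memL (by norm_num)).mono_set hs).mul ((hu j).2 α).2.memL_four_ball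
  exact MemLp.add (MemLp.add (MemLp.neg (memLp_finsetSum _ fun j _ =>
    memLp_finsetSum _ fun α _ => h1 j α)) (memLp_finsetSum _ fun j _ =>
    memLp_finsetSum _ fun α _ => h2 j α)) ((hc.f_memL_one i).mono_set hs)

lemma MemL.weakLaplacian {Ω : Set E4} {g : E4 → ℝ} (h : MemW22 Ω g) :
    MemL 2 Ω (weakLaplacian Ω g) :=
  memLp_finsetSum _ fun α _ => h.memL_weakDeriv₂ α α

/-! ### Weak derivatives on the ball and on the punctured ball -/

section Comparison

variable {g : E4 → ℝ}

/-- A derivative in the ball restricts to the punctured ball, where it is unique, and the removed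
point is a null set. -/
lemma weakDeriv_punctured_ae_eq {α : Fin 4} {h : E4 → ℝ} (H : HasWeakDeriv B1 α g h) :
    weakDeriv (B1 \ {0}) α g =ᵐ[volume.restrict B1] h := by
  rw [← restrict_B1_diff_singleton]
  exact (H.mono sdiff_subset).weakDeriv_ae_eq (isOpen_B1.sdiff isClosed_singleton)

lemma weakDeriv₂_punctured_ae_eq {α β : Fin 4} {D H : E4 → ℝ} (hD : HasWeakDeriv B1 α g D)
    (hH : HasWeakDeriv B1 β D H) :
    weakDeriv₂ (B1 \ {0}) β α g =ᵐ[volume.restrict B1] H := by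
  rw [← restrict_B1_diff_singleton]
  exact weakDeriv₂_ae_eq (isOpen_B1.sdiff isClosed_singleton) (hD.mono sdiff_subset)
    (hH.mono sdiff_subset)

end Comparison

/-! ### Passage to the limit in the truncated equation -/

/-- Removable singularities of weak solutions of the inhomogeneous Lamm–Rivière system. -/
theorem IsWeakSolution.of_punctured {n : ℕ} {c : Coefficients n} (hc : c.Admissible B1)
    {u : Fin n → E4 → ℝ} (hu : ∀ i, MemW22 B1 (u i)) (hsol : IsWeakSolution (B1 \ {0}) c u) :
    IsWeakSolution B1 c u := by
  refine ⟨hu, fun φ hφ => ?_⟩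
  have hs := ball_half_subset_B1
  have hoP : IsOpen (B1 \ {(0 : E4)}) := isOpen_B1.sdiff isClosed_singleton
  obtain ⟨C, hC⟩ := exists_cutoff
  -- Taking R = k + 2 ≥ 2 places every error term inside the half ball.
  choose η hηb hη0 hη1 hηd hηs using fun k : ℕ => hC ((k : ℝ) + 2) (by
    have : (0 : ℝ) ≤ k := k.cast_nonneg
    linarith)
  have hηsm : ∀ k, IsSmooth (η k) := fun k => (hηb k).smooth
  have hW : ∀ i, MemW22 B1 (φ i) := fun i => (hφ i).1.1
  have hφt : ∀ i, MemL ∞ (Metric.ball 0 (1 / 2)) (φ i) := fun i => (hφ i).2.mono_set hs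
  have dφ4 : ∀ i α, MemL 4 (Metric.ball 0 (1 / 2)) (weakDeriv B1 α (φ i)) := fun i α =>
    ((hW i).2 α).2.memL_four_ball
  have lap2 : ∀ i, MemL 2 (Metric.ball 0 (1 / 2)) (weakLaplacian B1 (u i)) := fun i =>
    (MemL.weakLaplacian (hu i)).mono_set hs
  -- the truncated test functions
  have htest : ∀ k i, MemW022 (B1 \ {0}) (fun x => φ i x * η k x) ∧
      MemL ∞ (B1 \ {0}) (fun x => φ i x * η k x) := fun k i =>
    ⟨(hφ i).1.mul_smooth isOpen_B1 hoP sdiff_subset (hηb k) fun x hx =>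
        ⟨hx.1, fun h0 => hη0 k (by rw [← mem_singleton_iff.1 h0]; exact hx.2)⟩,
      ((hφ i).2.mul_of_continuous_of_bound (hηsm k).continuous (hηb k).bound).mono_set
        sdiff_subset⟩
  have heq := fun k => hsol.2 (fun i x => φ i x * η k x) (htest k)
  simp_rw [rhs_eq_sum_coeff, restrict_B1_diff_singleton] at heq
  simp_rw [rhs_eq_sum_coeff]
  -- decay of the commutator terms
  have van0 : ∀ {A : E4 → ℝ}, MemL 1 (Metric.ball 0 (1 / 2)) A →
      VanishesInL1 (fun k x => A x * (η k x - 1)) := fun {A} hA =>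
    vanishesInL1_mul (p := 1) (m := 0) (C := C) le_rfl (by norm_num)
      (by simpa using hA) (fun k => (hηsm k).continuous.sub continuous_const)
      (fun k x => by rw [abs_sub_comm, pow_zero, mul_one]; exact hη1 k x)
      (fun k x hx => by linarith [(hηs k x hx).1])
  -- Critical exponent for one derivative of the cutoff: 4(1 - 3/4) = 1. For two derivatives it is
  -- 4(1 - 1/2) = 2.
  have van1 : ∀ {A : E4 → ℝ} (α : Fin 4),
      MemL (ENNReal.ofReal (4 / 3)) (Metric.ball 0 (1 / 2)) A →
      VanishesInL1 (fun k x => A x * pd α (η k) x) := fun {A} α hA =>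
    vanishesInL1_mul (p := 4 / 3) (m := 1) (C := C) (by norm_num) (by norm_num) hA
      (fun k => ((hηsm k).pd α).continuous) (fun k x => by rw [pow_one]; exact hηd k α x)
      (fun k x hx => ((hηs k x hx).2 α).1)
  have van2 : ∀ {A : E4 → ℝ} (β α : Fin 4), MemL 2 (Metric.ball 0 (1 / 2)) A →
      VanishesInL1 (fun k x => A x * pd β (pd α (η k)) x) := fun {A} β α hA =>
    vanishesInL1_mul (p := 2) (m := 2) (C := C) (by norm_num) (by norm_num)
      (by simpa using hA) (fun k => (((hηsm k).pd α).pd β).continuous)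
      (fun k x => (hηb k).bound_pd_pd β α x) (fun k x hx => ((hηs k x hx).2 α).2 β)
  -- convergence of the left-hand side
  have hL := VanishesInL1.tendsto_integral
    (E := fun k x => ∑ i, weakLaplacian (B1 \ {0}) (u i) x *
      weakLaplacian (B1 \ {0}) (fun y => φ i y * η k y) x)
    (e := fun x => ∑ i, weakLaplacian B1 (u i) x * weakLaplacian B1 (φ i) x)
    -- Leibniz rule: Δ(φη) - Δφ = Δφ (η - 1) + 2 ∇φ·∇η + φ Δη.
    (D := fun k x => ∑ i, ∑ α,
      (((weakLaplacian B1 (u i) x * weakDeriv₂ B1 α α (φ i) x) * (η k x - 1)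
      + (2 * (weakLaplacian B1 (u i) x * weakDeriv B1 α (φ i) x)) * pd α (η k) x)
      + (weakLaplacian B1 (u i) x * φ i x) * pd α (pd α (η k)) x))
    (VanishesInL1.sum fun i => VanishesInL1.sum fun α =>
      ((van0 ((lap2 i).mul (((hW i).memL_weakDeriv₂ α α).mono_set hs))).add
        (van1 α (MemLp.const_mul ((lap2 i).mul (dφ4 i α)) 2))).add
        (van2 α α ((lap2 i).mul (hφt i))))
    (fun k => by
      have a1 : ∀ i α, weakDeriv₂ (B1 \ {0}) α α (u i) =ᵐ[volume.restrict B1]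
          weakDeriv₂ B1 α α (u i) := fun i α =>
        weakDeriv₂_punctured_ae_eq ((hu i).hasWeakDeriv α) ((hu i).hasWeakDeriv₂ α α)
      have a2 := fun i α => weakDeriv₂_punctured_ae_eq
        (((hW i).hasWeakDeriv α).mul_smooth isOpen_B1 (hηsm k))
        ((hW i).hasWeakDeriv_mul_smooth₂ isOpen_B1 (hηsm k) α α)
      filter_upwards [ae_all_iff.2 fun i => ae_all_iff.2 fun α => a1 i α,
        ae_all_iff.2 fun i => ae_all_iff.2 fun α => a2 i α] with x h1 h2
      rw [← Finset.sum_sub_distrib]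
      refine Finset.sum_congr rfl fun i _ => ?_
      have e1 : weakLaplacian (B1 \ {0}) (u i) x = weakLaplacian B1 (u i) x :=
        Finset.sum_congr rfl fun α _ => h1 i α
      rw [e1, ← mul_sub]
      rw [weakLaplacian.eq_def (B1 \ {0}), weakLaplacian.eq_def B1 (φ i)]
      rw [← Finset.sum_sub_distrib, Finset.mul_sum]
      refine Finset.sum_congr rfl fun α _ => ?_
      rw [h2 i α]
      ring)
  -- convergence of the right-hand side
  have hR := VanishesInL1.tendsto_integral
    (E := fun k x => ∑ i, (∑ β, gradCoeff (B1 \ {0}) c u i β x *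
      weakDeriv (B1 \ {0}) β (fun y => φ i y * η k y) x
      + valCoeff (B1 \ {0}) c u i x * (φ i x * η k x)))
    (e := fun x => ∑ i, (∑ β, gradCoeff B1 c u i β x * weakDeriv B1 β (φ i) x
      + valCoeff B1 c u i x * φ i x))
    -- Leibniz rule: ∂(φη) - ∂φ = ∂φ (η - 1) + φ ∂η. The last term needs φ bounded, to keep its
    -- coefficient in L^{4/3}.
    (D := fun k x => ∑ i, (∑ β,
      ((gradCoeff B1 c u i β x * weakDeriv B1 β (φ i) x) * (η k x - 1)
      + (gradCoeff B1 c u i β x * φ i x) * pd β (η k) x)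
      + (valCoeff B1 c u i x * φ i x) * (η k x - 1)))
    (VanishesInL1.sum fun i => (VanishesInL1.sum fun β =>
      (van0 ((gradCoeff_memL hc hu i β).mul (dφ4 i β))).add
        (van1 β ((gradCoeff_memL hc hu i β).mul (hφt i)))).add
        (van0 ((valCoeff_memL hc hu i).mul (hφt i))))
    (fun k => by
      have a1 : ∀ i α, weakDeriv (B1 \ {0}) α (u i) =ᵐ[volume.restrict B1]
          weakDeriv B1 α (u i) := fun i α => weakDeriv_punctured_ae_eq ((hu i).hasWeakDeriv α)
      have a2 : ∀ i β α, weakDeriv₂ (B1 \ {0}) β α (u i) =ᵐ[volume.restrict B1]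
          weakDeriv₂ B1 β α (u i) := fun i β α =>
        weakDeriv₂_punctured_ae_eq ((hu i).hasWeakDeriv α) ((hu i).hasWeakDeriv₂ β α)
      have a3 : ∀ i j α β, weakDeriv (B1 \ {0}) β (fun y => c.V α y i j)
          =ᵐ[volume.restrict B1] weakDeriv B1 β (fun y => c.V α y i j) := fun i j α β =>
        weakDeriv_punctured_ae_eq ((hc.V_mem α i j).2 β).1
      have a4 := fun i α => weakDeriv_punctured_ae_eq
        (((hW i).hasWeakDeriv α).mul_smooth isOpen_B1 (hηsm k))
      filter_upwards [ae_all_iff.2 fun i => ae_all_iff.2 fun α => a1 i α,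
        ae_all_iff.2 fun i => ae_all_iff.2 fun β => ae_all_iff.2 fun α => a2 i β α,
        ae_all_iff.2 fun i => ae_all_iff.2 fun j => ae_all_iff.2 fun α => ae_all_iff.2 fun β =>
          a3 i j α β,
        ae_all_iff.2 fun i => ae_all_iff.2 fun α => a4 i α] with x h1 h2 h3 h4
      have g1 : ∀ i β, gradCoeff (B1 \ {0}) c u i β x = gradCoeff B1 c u i β x := fun i β => by
        simp only [gradCoeff, h1, h2, h3]
      have g2 : ∀ i, valCoeff (B1 \ {0}) c u i x = valCoeff B1 c u i x := fun i => by
        simp only [valCoeff, h1, h2]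
      rw [← Finset.sum_sub_distrib]
      refine Finset.sum_congr rfl fun i _ => ?_
      rw [g2, add_sub_add_comm, ← Finset.sum_sub_distrib]
      congr 1
      · refine Finset.sum_congr rfl fun β _ => ?_
        rw [g1, h4]
        ring
      · ring)
  exact tendsto_nhds_unique hL (hR.congr fun k => (heq k).symm)

end LammRiviere

end

theorem mainTheorem3 (n : ℕ) (c : LammRiviere.Coefficients n)
    (hc : c.Admissible LammRiviere.B1)
    (u : Fin n → LammRiviere.E4 → ℝ)
    (hu : ∀ i, LammRiviere.MemW22 LammRiviere.B1 (u i))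
    (hsol : LammRiviere.IsWeakSolution (LammRiviere.B1 \ {0}) c u) :
    LammRiviere.IsWeakSolution LammRiviere.B1 c u :=
  LammRiviere.IsWeakSolution.of_punctured hc hu hsol
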